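/- Let $A=\{\zeta\in\mathbb C:1<|\zeta|<2\}$. There exist a constant $c>1$, a bounded subharmonic function $u:A\to\mathbb R$ and pairwise disjoint open sets $E_n\subset A$, $n=0,1,2,\dots$, such that (i) each $E_n$ is a union of some connected components of $\{\zeta\in A:u(\zeta)<0\}$; (ii) for every $r$ with $1<r<2$ and every $n$, $$\int_{\{\theta\in(-\pi,\pi]\,:\,re^{i\theta}\in E_n\}}u(re^{i\theta})\,d\theta\le -c^{-n}.$$ Moreover, $u$ and the sets $E_n$ can be chosen self-similar in the following sense. Let $S=\{z:|\operatorname{Im}z|<4/3\}$, and for $n=0,1,2,\dots$ and $k\in\mathbb Z$ let $\gamma_{n,k}(z)=2^{-n}(z+k)$; these maps form the semigroup generated by $z\mapsto z\pm1$ and $z\mapsto z/2$. There are $\varepsilon\in(0,\pi)$, $M>1$, a subharmonic function $v:S\to\mathbb R$ and an open set $W\subset S$ such that, with $F_n=\bigcup_{k\in\mathbb Z}\gamma_{n,k}(W)$, for all $n\ge 0$ and $k\in\mathbb Z$: - $v(\gamma_{n,k}(z))\ge M^{-n}v(z)$ for $z\in S$ (in particular $v(z+1)=v(z)$), with equality for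 $z\in W$; - $F_n$ is a union of some connected components of $\{z\in S:v(z)<0\}$; - $u(e^{3\varepsilon z/4})=v(z)$ for every $z\in S$ with $e^{3\varepsilon z/4}\in A$; - $E_n=A\cap\{e^{3\varepsilon z/4}:z\in F_n\}$. -/

import Mathlib

open Set MeasureTheory

/-- A real-valued function `u` is subharmonic on the open set `Ω`: it is upper semicontinuous there,
and `u a` is at most the mean of `u` over every circle about `a` whose closed disc lies in `Ω`. -/
structure IsSubharmonicOn (u : ℂ → ℝ) (Ω : Set ℂ) : Prop where
  upperSemicontinuousOn : UpperSemicontinuousOn u Ω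
  circleIntegrable : ∀ a : ℂ, ∀ r : ℝ, 0 < r → Metric.closedBall a r ⊆ Ω → CircleIntegrable u a r
  le_circleAverage : ∀ a : ℂ, ∀ r : ℝ, 0 < r → Metric.closedBall a r ⊆ Ω →
    u a ≤ Real.circleAverage u a r

/-- `E` is the union of some (possibly none, possibly all) of the connected components of `N`. -/
def IsUnionOfComponents (E N : Set ℂ) : Prop :=
  ∃ T : Set ℂ, T ⊆ N ∧ E = ⋃ z ∈ T, connectedComponentIn N z

/-- The annulus `1 < |ζ| < 2`. -/
def annulus : Set ℂ := {ζ | 1 < ‖ζ‖ ∧ ‖ζ‖ < 2}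

/-- The strip `|Im z| < 4/3`. -/
def strip : Set ℂ := {z | |z.im| < 4 / 3}

/-- The element `z ↦ 2⁻ⁿ (z + k)` of the semigroup generated by `z ↦ z + 1`, `z ↦ z - 1` and
`z ↦ z / 2`. -/
noncomputable def dyadicMap (n : ℕ) (k : ℤ) (z : ℂ) : ℂ := (z + k) / 2 ^ n

/-- The union over `k` of the images of `W` under `z ↦ 2⁻ⁿ (z + k)`. -/
def dyadicLevel (W : Set ℂ) (n : ℕ) : Set ℂ := ⋃ k : ℤ, dyadicMap n k '' W

/-- The function `v` on the strip and the open set `W` in it are self-similar, with factor `M`, under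
the semigroup of the maps `z ↦ 2⁻ⁿ (z + k)`. The case `n = 0` of `le_map` contains `v (z + 1) = v z`. -/
structure IsSelfSimilar (v : ℂ → ℝ) (W : Set ℂ) (M : ℝ) : Prop where
  isOpen : IsOpen W
  subset : W ⊆ strip
  le_map : ∀ (n : ℕ) (k : ℤ), ∀ z ∈ strip, (M ^ n)⁻¹ * v z ≤ v (dyadicMap n k z)
  map_eq : ∀ (n : ℕ) (k : ℤ), ∀ z ∈ W, v (dyadicMap n k z) = (M ^ n)⁻¹ * v z
  components : ∀ n : ℕ, IsUnionOfComponents (dyadicLevel W n) {z | z ∈ strip ∧ v z < 0}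

/-! Everything rests on one function on the band `2/3 ≤ Im z ≤ 4/3`. There `band` is an oscillating
harmonic function `hump`, joined by maxima to the affine functions `lowLine` at the bottom and
`highLine` at the top. Since `highLine (2 * z) = growth * lowLine z`, copies of the band, halved in
size and divided by `growth`, fit together across the lines `Im z = (2/3) 2⁻ⁿ`, near which the
function is affine and on which it is positive. These lines separate the negativity set into levels,
which gives the disjointness and the components.

The resulting function, extended by zero to the lower half-plane, is `halfLimit`, and `v(z) =
halfLimit z + halfLimit (-z)`. The upper wells serve the vertical lines with `sin (10πx) ≥ 0`, their
half-turned copies serve the others. Hence every vertical line has, at level `n`, a segment of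
length proportional to `2⁻ⁿ` on which `v ≤ -60 growth⁻ⁿ`, and `c = 2 * growth` results. A logarithm
carries `v` to the right half of the annulus, and a linear function of `Re ζ` continues it to the
left half.

Subharmonicity is checked pointwise through `HarmonicSupportAt`, a condition stable under maxima,
sums and analytic substitution, which implies the mean value inequality on all discs
(`HarmonicSupportAt.isSubharmonicOn`). The bands accumulate at the real axis; there `v` is treated
as a uniform limit of functions with finitely many bands. -/

open Filter Topology Metric

/-! ### Subharmonicity from local harmonic supports, and its stability under uniform limits. -/

/-- Continuous functions on a circle are uniformly approximated by real parts of entire functions. -/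
theorem exists_differentiable_re_approx {f : ℂ → ℝ} {a : ℂ} {r : ℝ} (hr : 0 < r)
    (hf : ContinuousOn f (sphere a r)) {δ : ℝ} (hδ : 0 < δ) :
    ∃ p : ℂ → ℂ, Differentiable ℂ p ∧ ∀ z ∈ sphere a r, |f z - (p z).re| ≤ δ := by
  have : Fact (0 < 2 * Real.pi) := ⟨Real.two_pi_pos⟩
  have hmem : ∀ t : AddCircle (2 * Real.pi), a + r * (AddCircle.toCircle t : ℂ) ∈ sphere a r := by
    intro t
    rw [mem_sphere_iff_norm, add_sub_cancel_left, norm_mul, Circle.norm_coe, mul_one,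
      Complex.norm_real, Real.norm_of_nonneg hr.le]
  let g : C(AddCircle (2 * Real.pi), ℂ) :=
    ⟨fun t => ((f (a + r * (AddCircle.toCircle t : ℂ)) : ℝ) : ℂ), by
      refine Complex.continuous_ofReal.comp (hf.comp_continuous ?_ hmem)
      have := AddCircle.continuous_toCircle (T := 2 * Real.pi)
      fun_prop⟩
  -- Real parts are not `ℂ`-linear, so the induction carries an arbitrary complex factor `c`.
  have hspan : ∀ h ∈ Submodule.span ℂ (range (fourier (T := 2 * Real.pi))),
      ∀ c : ℂ, ∃ p : ℂ → ℂ, Differentiable ℂ p ∧ ∀ t : AddCircle (2 * Real.pi),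
        (c * h t).re = (p (AddCircle.toCircle t : ℂ)).re := by
    intro h hh
    induction hh using Submodule.span_induction with
    | mem x hx =>
      obtain ⟨n, rfl⟩ := hx
      intro c
      obtain ⟨k, rfl | rfl⟩ := n.eq_nat_or_neg
      · refine ⟨fun z => c * z ^ k, by fun_prop, fun t => ?_⟩
        simp [fourier_apply, AddCircle.toCircle_nsmul]
      -- On the unit circle `c z⁻ᵏ` is the conjugate of `conj c · zᵏ`, so negative frequencies cause
      -- no poles.
      · refine ⟨fun z => (starRingEnd ℂ) c * z ^ k, by fun_prop, fun t => ?_⟩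
        rw [fourier_neg, ← Complex.conj_re]
        simp [fourier_apply, AddCircle.toCircle_nsmul]
    | zero => exact fun c => ⟨fun _ => 0, by fun_prop, by simp⟩
    | add x y _ _ hx hy =>
      intro c
      obtain ⟨p, hp, hp'⟩ := hx c
      obtain ⟨q, hq, hq'⟩ := hy c
      refine ⟨fun z => p z + q z, hp.add hq, fun t => ?_⟩
      simp only [ContinuousMap.add_apply, mul_add, Complex.add_re, hp', hq']
    | smul b x _ hx =>
      intro c
      obtain ⟨p, hp, hp'⟩ := hx (c * b)
      refine ⟨p, hp, fun t => ?_⟩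
      rw [← hp' t, ContinuousMap.smul_apply, smul_eq_mul, mul_assoc]
  have hg : g ∈ (Submodule.span ℂ (range (fourier (T := 2 * Real.pi)))).topologicalClosure := by
    rw [span_fourier_closure_eq_top]; trivial
  rw [← SetLike.mem_coe, Submodule.topologicalClosure_coe, Metric.mem_closure_iff] at hg
  obtain ⟨h, hh, hgh⟩ := hg δ hδ
  obtain ⟨p, hp, hp'⟩ := hspan h hh 1
  refine ⟨fun z => p ((z - a) / r), by fun_prop, fun z hz => ?_⟩
  have hz' : ‖(z - a) / r‖ = 1 := by
    rw [mem_sphere_iff_norm] at hz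
    rw [norm_div, hz, Complex.norm_real, Real.norm_of_nonneg hr.le, div_self hr.ne']
  obtain ⟨t, ht⟩ := (AddCircle.homeomorphCircle (T := 2 * Real.pi) (by positivity)).surjective
    (⟨(z - a) / r, mem_sphere_zero_iff_norm.2 hz'⟩ : Circle)
  have ht' : (AddCircle.toCircle t : ℂ) = (z - a) / r := by
    have := congrArg (Subtype.val : Circle → ℂ) ht
    simpa [AddCircle.homeomorphCircle_apply] using this
  have hz2 : z = a + r * (AddCircle.toCircle t : ℂ) := by
    rw [ht', mul_div_cancel₀ _ (by exact_mod_cast hr.ne')]; ring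
  have h1 : (g t).re = f z := by
    change ((f (a + r * (AddCircle.toCircle t : ℂ)) : ℝ) : ℂ).re = f z
    rw [← hz2, Complex.ofReal_re]
  have h2 : (h t).re = (p ((z - a) / r)).re := by
    rw [← ht', ← hp' t, one_mul]
  simp only
  rw [← h1, ← h2, ← Complex.sub_re]
  calc |(g t - h t).re| ≤ ‖g t - h t‖ := Complex.abs_re_le_norm _
    _ = dist (g t) (h t) := (dist_eq_norm _ _).symm
    _ ≤ dist g h := ContinuousMap.dist_apply_le_dist t
    _ ≤ δ := hgh.le

/-- `f` is continuous at `z` and touched from below at `z` by the real part of an analytic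
function. -/
structure HarmonicSupportAt (f : ℂ → ℝ) (z : ℂ) : Prop where
  continuousAt : ContinuousAt f z
  exists_support : ∃ F : ℂ → ℂ, AnalyticAt ℂ F z ∧ (F z).re = f z ∧ ∀ᶠ w in 𝓝 z, (F w).re ≤ f w

namespace HarmonicSupportAt

theorem of_analyticAt {F : ℂ → ℂ} {z : ℂ} (hF : AnalyticAt ℂ F z) :
    HarmonicSupportAt (fun w => (F w).re) z :=
  ⟨Complex.continuous_re.continuousAt.comp hF.continuousAt,
    F, hF, rfl, Eventually.of_forall fun _ => le_rfl⟩

theorem congr {f g : ℂ → ℝ} {z : ℂ} (hf : HarmonicSupportAt f z) (h : g =ᶠ[𝓝 z] f) :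
    HarmonicSupportAt g z := by
  obtain ⟨hc, F, hF, hz, hle⟩ := hf
  exact ⟨hc.congr h.symm, F, hF, hz.trans h.eq_of_nhds.symm, by
    filter_upwards [hle, h] with w h1 h2 using h2 ▸ h1⟩

theorem comp {f : ℂ → ℝ} {φ : ℂ → ℂ} {z : ℂ} (hf : HarmonicSupportAt f (φ z))
    (hφ : AnalyticAt ℂ φ z) : HarmonicSupportAt (fun w => f (φ w)) z := by
  obtain ⟨hc, F, hF, hz, hle⟩ := hf
  exact ⟨hc.comp (f := φ) hφ.continuousAt, F ∘ φ, hF.comp hφ, hz,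
    hφ.continuousAt.eventually hle⟩

theorem max {f g : ℂ → ℝ} {z : ℂ} (hf : HarmonicSupportAt f z) (hg : HarmonicSupportAt g z) :
    HarmonicSupportAt (fun w => max (f w) (g w)) z := by
  refine ⟨hf.continuousAt.max hg.continuousAt, ?_⟩
  rcases le_total (f z) (g z) with h | h
  · obtain ⟨F, hF, hz, hle⟩ := hg.exists_support
    exact ⟨F, hF, by rw [hz, max_eq_right h], hle.mono fun w hw => hw.trans (le_max_right _ _)⟩
  · obtain ⟨F, hF, hz, hle⟩ := hf.exists_support
    exact ⟨F, hF, by rw [hz, max_eq_left h], hle.mono fun w hw => hw.trans (le_max_left _ _)⟩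

theorem const_mul {f : ℂ → ℝ} {z : ℂ} (hf : HarmonicSupportAt f z) {c : ℝ} (hc : 0 ≤ c) :
    HarmonicSupportAt (fun w => c * f w) z := by
  obtain ⟨hcont, F, hF, hz, hle⟩ := hf
  refine ⟨continuousAt_const.mul hcont, fun w => (c : ℂ) * F w, analyticAt_const.mul hF, ?_, ?_⟩
  · simp [hz]
  · filter_upwards [hle] with w hw
    simpa using mul_le_mul_of_nonneg_left hw hc

/-- Maximum principle: a function with harmonic supports in a disc is bounded there by its
values on the boundary circle, up to the real part of an entire function. -/
theorem le_of_le_sphere {f : ℂ → ℝ} {p : ℂ → ℂ} {a : ℂ} {r δ : ℝ} (hr : 0 < r)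
    (hf : ∀ z ∈ closedBall a r, HarmonicSupportAt f z) (hp : Differentiable ℂ p)
    (hδ : ∀ z ∈ sphere a r, f z - (p z).re ≤ δ) : f a - (p a).re ≤ δ := by
  by_contra! hcon
  set k : ℂ → ℝ := fun z => f z - (p z).re with hk
  have hkc : ContinuousOn k (closedBall a r) := fun z hz =>
    ((hf z hz).continuousAt.sub
      (Complex.continuous_re.comp hp.continuous).continuousAt).continuousWithinAt
  obtain ⟨b, hb, hmax⟩ := (isCompact_closedBall a r).exists_isMaxOn
    ⟨a, mem_closedBall_self hr.le⟩ hkc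
  have hb' : ∀ z ∈ closedBall a r, k z ≤ k b := fun z hz => hmax hz
  set K : Set ℂ := {z | z ∈ closedBall a r ∧ k z = k b} with hK
  have hKc : IsCompact K := by
    have : K = closedBall a r ∩ k ⁻¹' {k b} := rfl
    rw [this]
    exact (isCompact_closedBall a r).of_isClosed_subset
      (hkc.preimage_isClosed_of_isClosed isClosed_closedBall isClosed_singleton)
      inter_subset_left
  -- Take a maximum point of `k` farthest from the centre. The support at `z` will force `k` to be
  -- constant near `z`, so a point slightly farther out is again a maximum point, a contradiction.
  obtain ⟨z, hzK, hzmax⟩ := hKc.exists_isMaxOn ⟨b, hb, rfl⟩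
    (continuous_id.dist continuous_const : Continuous fun w : ℂ => dist w a).continuousOn
  have hzfar : ∀ w ∈ K, dist w a ≤ dist z a := fun w hw => hzmax hw
  have hzball : z ∈ ball a r := by
    rw [mem_ball]
    refine lt_of_le_of_ne hzK.1 fun h => ?_
    have h1 := hδ z h
    have h2 := hb' a (mem_closedBall_self hr.le)
    rw [← hzK.2] at h2
    exact absurd (hcon.trans_le h2) (not_lt.2 h1)
  obtain ⟨F, hF, hFz, hle⟩ := (hf z hzK.1).exists_support
  have hball : ∀ᶠ w in 𝓝 z, w ∈ closedBall a r :=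
    mem_of_superset (isOpen_ball.mem_nhds hzball) ball_subset_closedBall
  have hpz : AnalyticAt ℂ p z := hp.analyticAt z
  -- The support lies below `f` and touches it at `z`, so `Re (F - p)` inherits the maximum;
  -- exponentiating turns this into the maximum modulus principle.
  have hlocmax : IsLocalMax (norm ∘ fun w => Complex.exp (F w - p w)) z := by
    filter_upwards [hle, hball] with w hw hwb
    simp only [Function.comp_apply, Complex.norm_exp, Complex.sub_re]
    apply Real.exp_le_exp.2
    have h1 := hb' w hwb
    rw [← hzK.2] at h1
    simp only [hk] at h1
    linarith
  have hdiff : ∀ᶠ w in 𝓝 z, DifferentiableAt ℂ (fun w => Complex.exp (F w - p w)) w := by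
    filter_upwards [hF.eventually_analyticAt] with w hw
    exact (hw.differentiableAt.sub (hp w)).cexp
  have hconst := Complex.eventually_eq_of_isLocalMax_norm hdiff hlocmax
  have hnear : ∀ᶠ w in 𝓝 z, w ∈ K := by
    filter_upwards [hconst, hle, hball] with w hw hwle hwb
    refine ⟨hwb, le_antisymm (hb' w hwb) ?_⟩
    have h1 := congrArg norm hw
    simp only [Complex.norm_exp, Complex.sub_re, Real.exp_eq_exp] at h1
    rw [← hzK.2]
    simp only [hk]
    linarith
  obtain ⟨ρ, hρ, hρK⟩ := Metric.eventually_nhds_iff_ball.1 hnear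
  have hstep : ∀ d : ℂ, ‖d‖ = 1 → z + (ρ / 2 : ℝ) * d ∈ K := fun d hd => hρK _ (by
    rw [mem_ball, dist_self_add_left, norm_mul, hd, mul_one, Complex.norm_real,
      Real.norm_of_nonneg (by positivity)]
    linarith)
  rcases eq_or_ne z a with rfl | hza
  · have := hzfar _ (hstep 1 norm_one)
    rw [dist_self, dist_self_add_left, mul_one, Complex.norm_real,
      Real.norm_of_nonneg (by positivity)] at this
    linarith
  · have hn : ‖z - a‖ ≠ 0 := norm_ne_zero_iff.2 (sub_ne_zero.2 hza)
    have := hzfar _ (hstep ((z - a) / (‖z - a‖ : ℝ)) (by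
      rw [norm_div, Complex.norm_real, norm_norm, div_self hn]))
    have hrw : z + (ρ / 2 : ℝ) * ((z - a) / (‖z - a‖ : ℝ)) - a
        = ((1 + ρ / 2 / ‖z - a‖ : ℝ) : ℂ) * (z - a) := by
      push_cast; ring
    rw [dist_eq_norm, dist_eq_norm, hrw, norm_mul, Complex.norm_real,
      Real.norm_of_nonneg (by positivity)] at this
    have hpos : 0 < ‖z - a‖ := lt_of_le_of_ne (norm_nonneg _) hn.symm
    have : 0 < ρ / 2 / ‖z - a‖ * ‖z - a‖ := by positivity
    linarith

/-- On the circle `f` is within `δ / 2` of some `Re p` with `p` entire. The maximum principle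
carries the upper bound to the centre, where `Re p` equals its own mean. -/
theorem isSubharmonicOn {f : ℂ → ℝ} {Ω : Set ℂ}
    (hf : ∀ z ∈ Ω, HarmonicSupportAt f z) : IsSubharmonicOn f Ω := by
  have hcont : ContinuousOn f Ω := fun z hz => (hf z hz).continuousAt.continuousWithinAt
  have hint : ∀ a : ℂ, ∀ r : ℝ, 0 < r → closedBall a r ⊆ Ω → CircleIntegrable f a r :=
    fun a r hr hsub => (hcont.mono (sphere_subset_closedBall.trans hsub)).circleIntegrable hr.le
  refine ⟨hcont.upperSemicontinuousOn, hint, fun a r hr hsub => ?_⟩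
  refine le_of_forall_pos_le_add fun δ hδ => ?_
  obtain ⟨p, hp, happ⟩ := exists_differentiable_re_approx hr
    (hcont.mono (sphere_subset_closedBall.trans hsub)) (half_pos hδ)
  have h1 : f a - (p a).re ≤ δ / 2 := le_of_le_sphere hr (fun z hz => hf z (hsub hz)) hp
    fun z hz => (abs_le.1 (happ z hz)).2
  have hpi : CircleIntegrable (fun z => (p z).re) a r :=
    (Complex.continuous_re.comp hp.continuous).continuousOn.circleIntegrable hr.le
  have h2 : Real.circleAverage (fun z => (p z).re) a r = (p a).re := by
    have h3 := Complex.reCLM.circleAverage_comp_comm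
      (hp.continuous.continuousOn.circleIntegrable (c := a) hr.le)
    have h4 : Real.circleAverage p a r = p a := hp.diffContOnCl.circleAverage
    rw [h4] at h3
    exact h3
  have h3 : Real.circleAverage (fun z => (p z).re) a r
      ≤ Real.circleAverage (fun z => f z + δ / 2) a r := by
    refine Real.circleAverage_mono hpi ((hint a r hr hsub).add (circleIntegrable_const _ _ _))
      fun z hz => ?_
    rw [abs_of_pos hr] at hz
    have := (abs_le.1 (happ z hz)).1
    linarith
  rw [Real.circleAverage_fun_add (hint a r hr hsub) (circleIntegrable_const _ _ _),
    Real.circleAverage_const] at h3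
  linarith

end HarmonicSupportAt

/-- Uniform limits of continuous subharmonic functions are subharmonic. -/
theorem IsSubharmonicOn.of_tendstoUniformlyOn {f : ℕ → ℂ → ℝ} {g : ℂ → ℝ} {Ω : Set ℂ}
    (hf : ∀ n, IsSubharmonicOn (f n) Ω) (hc : ∀ n, ContinuousOn (f n) Ω)
    (hlim : TendstoUniformlyOn f g atTop Ω) : IsSubharmonicOn g Ω := by
  have hcont : ContinuousOn g Ω := hlim.continuousOn (Eventually.of_forall hc).frequently
  have hint : ∀ a : ℂ, ∀ r : ℝ, 0 < r → closedBall a r ⊆ Ω → CircleIntegrable g a r :=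
    fun a r hr hsub => (hcont.mono (sphere_subset_closedBall.trans hsub)).circleIntegrable hr.le
  refine ⟨hcont.upperSemicontinuousOn, hint, fun a r hr hsub => ?_⟩
  refine le_of_forall_pos_le_add fun δ hδ => ?_
  obtain ⟨n, hn⟩ := (Metric.tendstoUniformlyOn_iff.1 hlim (δ / 2) (half_pos hδ)).exists
  have h1 := (hf n).le_circleAverage a r hr hsub
  have h2 : Real.circleAverage (f n) a r ≤ Real.circleAverage (fun z => g z + δ / 2) a r := by
    refine Real.circleAverage_mono ((hf n).circleIntegrable a r hr hsub)
      ((hint a r hr hsub).add (circleIntegrable_const _ _ _)) fun z hz => ?_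
    rw [abs_of_pos hr] at hz
    have := hn z (hsub (sphere_subset_closedBall hz))
    rw [Real.dist_eq, abs_lt] at this
    linarith
  rw [Real.circleAverage_fun_add (hint a r hr hsub) (circleIntegrable_const _ _ _),
    Real.circleAverage_const] at h2
  have h3 := hn a (hsub (mem_closedBall_self hr.le))
  rw [Real.dist_eq, abs_lt] at h3
  linarith

/-- Such an `E` is open and relatively closed in `N`, so a connected subset of `N` that meets it
stays inside. -/
theorem isUnionOfComponents_of_isOpen {E N : Set ℂ} (hEN : E ⊆ N) (hE : IsOpen E)
    (hcl : N ∩ closure E ⊆ E) : IsUnionOfComponents E N := by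
  refine ⟨E, hEN, Subset.antisymm ?_ ?_⟩
  · exact fun z hz => mem_iUnion₂.2 ⟨z, hz, mem_connectedComponentIn (hEN hz)⟩
  · refine iUnion₂_subset fun z hz => ?_
    have hpre : IsPreconnected (connectedComponentIn N z) := isPreconnected_connectedComponentIn
    have hsub := connectedComponentIn_subset N z
    by_contra hnot
    obtain ⟨w, hw, hwE⟩ := not_subset.1 hnot
    have hwc : w ∉ closure E := fun h => hwE (hcl ⟨hsub hw, h⟩)
    obtain ⟨t, _, htE, htc⟩ := hpre E (closure E)ᶜ hE isClosed_closure.isOpen_compl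
      (fun t ht => by
        by_cases h : t ∈ closure E
        · exact Or.inl (hcl ⟨hsub ht, h⟩)
        · exact Or.inr h)
      ⟨z, mem_connectedComponentIn (hEN hz), hz⟩ ⟨w, hw, hwc⟩
    exact htc (subset_closure htE)

theorem HarmonicSupportAt.add {f g : ℂ → ℝ} {z : ℂ} (hf : HarmonicSupportAt f z)
    (hg : HarmonicSupportAt g z) : HarmonicSupportAt (fun w => f w + g w) z := by
  obtain ⟨hc, F, hF, hz, hle⟩ := hf
  obtain ⟨hc', G, hG, hz', hle'⟩ := hg
  refine ⟨hc.add hc', fun w => F w + G w, hF.add hG, by simp [hz, hz'], ?_⟩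
  filter_upwards [hle, hle'] with w h h'
  simpa using add_le_add h h'

/-! ### The function on the fundamental band. -/

/-- The exponential `exp (-10 π (i z + 1))`, of modulus `exp (10 π (Im z - 1))`. -/
noncomputable def wave (z : ℂ) : ℂ := Complex.exp (-(10 * Real.pi) * (Complex.I * z + 1))

theorem norm_wave (z : ℂ) : ‖wave z‖ = Real.exp (10 * Real.pi * (z.im - 1)) := by
  rw [wave, Complex.norm_exp]
  congr 1
  simp
  ring

theorem wave_add_int (z : ℂ) (k : ℤ) : wave (z + k) = wave z := by
  rw [wave, wave, Complex.exp_eq_exp_iff_exists_int]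
  exact ⟨-5 * k, by push_cast; ring⟩

theorem differentiable_wave : Differentiable ℂ wave := by
  unfold wave; fun_prop

/-- The harmonic oscillation used in the fundamental band. -/
noncomputable def ripple (z : ℂ) : ℝ := (Complex.I * wave z + wave z ^ 2 / 2).re

theorem abs_ripple_le (z : ℂ) : |ripple z| ≤ ‖wave z‖ + ‖wave z‖ ^ 2 / 2 := by
  refine (Complex.abs_re_le_norm _).trans ((norm_add_le _ _).trans ?_)
  simp

/-- With `b = Im (wave z)`, `ripple z = |b| (1 - |b|) + ‖wave z‖² / 2` when `b ≤ 0`. The quadratic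
term keeps the bound on the boundary `b = 0`, so no vertical line is missed later. -/
theorem ripple_ge {z : ℂ} (h1 : (wave z).im ≤ 0) (h2 : 1 / 2 ≤ ‖wave z‖) (h3 : ‖wave z‖ ≤ 1) :
    1 / 8 ≤ ripple z := by
  have hq : ripple z = -(wave z).im + ((wave z).re ^ 2 - (wave z).im ^ 2) / 2 := by
    simp [ripple, sq]
  have hn : ‖wave z‖ ^ 2 = (wave z).re ^ 2 + (wave z).im ^ 2 := by
    rw [← Complex.normSq_eq_norm_sq, Complex.normSq_apply]; ring
  have him : -(wave z).im ≤ 1 := (neg_le_abs _).trans ((Complex.abs_im_le_norm _).trans h3)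
  nlinarith

/-- The value of `‖wave z‖` on the line `Im z = 4/3`. -/
noncomputable def topSize : ℝ := Real.exp (10 * Real.pi / 3)

/-- The scaling factor of the self-similar function. -/
noncomputable def growth : ℝ := 12 * (25 + 16 * topSize + 8 * topSize ^ 2)

theorem topSize_pos : 0 < topSize := Real.exp_pos _

theorem growth_gt : 300 < growth := by
  have := topSize_pos
  unfold growth; nlinarith [sq_nonneg topSize]

theorem growth_pos : 0 < growth := by linarith [growth_gt]

/-- The constant is what `Im z = 5/6` needs: there `hump - lowLine ≥ 15 - 960 (e + e² / 2)`, which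
is positive for `0 < e < 1/96`. -/
theorem exp_neg_bound {t : ℝ} (ht : 5 ≤ t) : Real.exp (-t) < 1 / 96 := by
  have h1 : Real.exp (-t) ≤ Real.exp (-5) := Real.exp_le_exp.2 (by linarith)
  have h2 : (Real.exp 1) ^ 5 = Real.exp 5 := by rw [← Real.exp_nat_mul]; norm_num
  have h3 : (2.7 : ℝ) ^ 5 ≤ Real.exp 5 := by
    rw [← h2]
    exact pow_le_pow_left₀ (by norm_num) (by linarith [Real.exp_one_gt_d9]) 5
  rw [Real.exp_neg 5] at h1
  refine h1.trans_lt ?_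
  rw [inv_eq_one_div]
  exact one_div_lt_one_div_of_lt (by norm_num) (lt_of_lt_of_le (by norm_num) h3)

/-- The harmonic function in the middle of the fundamental band. -/
noncomputable def hump (z : ℂ) : ℝ := 180 * (z.im - 2 / 3) - 960 * ripple z

/-- The function near the lower edge `Im z = 2/3` of the fundamental band. -/
noncomputable def lowLine (z : ℂ) : ℝ := 60 * z.im - 35

/-- The function near the upper edge `Im z = 4/3` of the fundamental band. -/
noncomputable def highLine (z : ℂ) : ℝ := growth * (30 * z.im - 35)

theorem highLine_two_mul (z : ℂ) : highLine (2 * z) = growth * lowLine z := by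
  simp [highLine, lowLine]
  left; ring

theorem continuous_hump : Continuous hump := by
  have := differentiable_wave.continuous
  have := Complex.continuous_re
  have := Complex.continuous_im
  unfold hump ripple
  fun_prop

theorem continuous_lowLine : Continuous lowLine := by
  have := Complex.continuous_im
  unfold lowLine
  fun_prop

theorem continuous_highLine : Continuous highLine := by
  have := Complex.continuous_im
  unfold highLine
  fun_prop

theorem harmonicSupportAt_affine_im (a b : ℝ) (z : ℂ) :
    HarmonicSupportAt (fun w => a * w.im + b) z := by
  have h : Differentiable ℂ fun w : ℂ => -(a * Complex.I) * w + b := by fun_prop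
  refine (HarmonicSupportAt.of_analyticAt (h.analyticAt z)).congr (Eventually.of_forall fun w => ?_)
  simp

theorem harmonicSupportAt_lowLine (z : ℂ) : HarmonicSupportAt lowLine z :=
  (harmonicSupportAt_affine_im 60 (-35) z).congr (Eventually.of_forall fun w => by
    simp [lowLine]; ring)

theorem harmonicSupportAt_highLine (z : ℂ) : HarmonicSupportAt highLine z :=
  (harmonicSupportAt_affine_im (growth * 30) (-(growth * 35)) z).congr
    (Eventually.of_forall fun w => by simp only [highLine]; ring)

theorem harmonicSupportAt_hump (z : ℂ) : HarmonicSupportAt hump z := by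
  have hw := differentiable_wave
  have h : Differentiable ℂ fun w : ℂ =>
      -(180 * Complex.I) * w - 120 - 960 * (Complex.I * wave w + wave w ^ 2 / 2) := by fun_prop
  refine (HarmonicSupportAt.of_analyticAt (h.analyticAt z)).congr (Eventually.of_forall fun w => ?_)
  have h1 : ((-(180 * Complex.I) * w - 120 - 960 * (Complex.I * wave w + wave w ^ 2 / 2)) : ℂ).re
      = 180 * w.im - 120 - 960 * ripple w := by
    rw [ripple]
    simp only [Complex.sub_re, Complex.mul_re, Complex.neg_re, Complex.neg_im, Complex.re_ofNat,
      Complex.im_ofNat, Complex.I_re, Complex.I_im, Complex.mul_im]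
    ring
  simp only [h1, hump]
  ring

theorem hump_lt_lowLine {z : ℂ} (hz : z.im = 2 / 3) : hump z < lowLine z := by
  have h1 := abs_le.1 (abs_ripple_le z)
  have h2 : ‖wave z‖ = Real.exp (-(5 * Real.pi / 3)) ^ 2 := by
    rw [norm_wave, hz, ← Real.exp_nat_mul]
    congr 1; push_cast; ring
  have h3 := exp_neg_bound (t := 5 * Real.pi / 3) (by linarith [Real.pi_gt_three])
  have h4 := Real.exp_pos (-(5 * Real.pi / 3))
  set e := Real.exp (-(5 * Real.pi / 3))
  have h5 : e ^ 2 < 1 / 9216 := by nlinarith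
  rw [h2] at h1
  have h6 : (e ^ 2) ^ 2 ≤ e ^ 2 := by nlinarith
  simp only [hump, lowLine, hz]
  linarith

theorem lowLine_lt_hump {z : ℂ} (hz : z.im = 5 / 6) : lowLine z < hump z := by
  have h1 := abs_le.1 (abs_ripple_le z)
  have h2 : ‖wave z‖ = Real.exp (-(5 * Real.pi / 3)) := by
    rw [norm_wave, hz]
    congr 1; ring
  have h3 := exp_neg_bound (t := 5 * Real.pi / 3) (by linarith [Real.pi_gt_three])
  have h4 := Real.exp_pos (-(5 * Real.pi / 3))
  set e := Real.exp (-(5 * Real.pi / 3))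
  rw [h2] at h1
  have h6 : e ^ 2 ≤ e := by nlinarith
  simp only [hump, lowLine, hz]
  linarith

theorem highLine_lt_hump {z : ℂ} (hz : z.im = 1) : highLine z < hump z := by
  have h1 := abs_le.1 (abs_ripple_le z)
  rw [norm_wave, hz] at h1
  simp only [sub_self, mul_zero, Real.exp_zero] at h1
  simp only [hump, highLine, hz]
  linarith [growth_gt]

/-- `growth` is defined for this bound: `|hump| ≤ 120 + 960 T + 480 T²` with `T = topSize`, while `5
* growth = 1500 + 960 T + 480 T²` is the value of `highLine` at `Im z = 4/3`. -/
theorem abs_hump_le {z : ℂ} (h0 : 0 ≤ z.im) (h1 : z.im ≤ 4 / 3) : |hump z| < 5 * growth := by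
  have h2 := abs_le.1 (abs_ripple_le z)
  have h3 : ‖wave z‖ ≤ topSize := by
    rw [norm_wave, topSize]
    refine Real.exp_le_exp.2 ?_
    nlinarith [Real.pi_pos]
  have h4 : ‖wave z‖ ^ 2 ≤ topSize ^ 2 := pow_le_pow_left₀ (norm_nonneg _) h3 2
  rw [abs_lt]
  simp only [hump, growth]
  constructor <;> linarith

theorem hump_lt_highLine {z : ℂ} (hz : z.im = 4 / 3) : hump z < highLine z := by
  refine (abs_lt.1 (abs_hump_le (by rw [hz]; norm_num) hz.le)).2.trans_le ?_
  simp only [highLine, hz]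
  linarith

/-- The height `1 / (20π)` keeps `‖wave z‖ ≥ exp (-1/2) ≥ 1/2`. Then `hump ≤ 180 / 3 - 960 / 8 =
-60`. -/
theorem hump_le_of_wave {z : ℂ} (h1 : (wave z).im ≤ 0) (h2 : 1 - 1 / (20 * Real.pi) ≤ z.im)
    (h3 : z.im ≤ 1) : hump z ≤ -60 := by
  have hpi := Real.pi_pos
  have h4 : -(1 / 2) ≤ 10 * Real.pi * (z.im - 1) := by
    have : 10 * Real.pi * (-(1 / (20 * Real.pi))) ≤ 10 * Real.pi * (z.im - 1) :=
      mul_le_mul_of_nonneg_left (by linarith) (by positivity)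
    refine le_trans (le_of_eq ?_) this
    field_simp
    norm_num
  have h5 : 1 / 2 ≤ ‖wave z‖ := by
    rw [norm_wave]
    linarith [Real.add_one_le_exp (10 * Real.pi * (z.im - 1))]
  have h6 : ‖wave z‖ ≤ 1 := by
    rw [norm_wave]
    exact Real.exp_le_one_iff.2 (by nlinarith)
  have := ripple_ge h1 h5 h6
  simp only [hump]
  linarith

/-- The self-similar function on the fundamental band `2/3 ≤ Im z ≤ 4/3`. -/
noncomputable def band (z : ℂ) : ℝ :=
  if z.im < 5 / 6 then max (lowLine z) (hump z)
  else if z.im ≤ 1 then hump z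
  else max (hump z) (highLine z)

theorem band_add_int (z : ℂ) (k : ℤ) : band (z + k) = band z := by
  simp [band, hump, ripple, wave_add_int, lowLine, highLine]

theorem eventually_im_lt {z : ℂ} {a : ℝ} (h : z.im < a) : ∀ᶠ w in 𝓝 z, w.im < a :=
  Complex.continuous_im.continuousAt.eventually_lt continuousAt_const h

theorem eventually_lt_im {z : ℂ} {a : ℝ} (h : a < z.im) : ∀ᶠ w in 𝓝 z, a < w.im :=
  continuousAt_const.eventually_lt Complex.continuous_im.continuousAt h

/-- The formula changes at `Im z = 5/6` and `Im z = 1`. On both lines `hump` strictly exceeds the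
competing affine function, so all the formulas equal `hump` nearby. -/
theorem harmonicSupportAt_band (z : ℂ) : HarmonicSupportAt band z := by
  rcases lt_trichotomy z.im (5 / 6) with h | h | h
  · refine ((harmonicSupportAt_lowLine z).max (harmonicSupportAt_hump z)).congr ?_
    filter_upwards [eventually_im_lt h] with w hw
    rw [band, if_pos hw]
  · refine (harmonicSupportAt_hump z).congr ?_
    filter_upwards [eventually_im_lt (h.trans_lt (by norm_num : (5 / 6 : ℝ) < 1)),
      continuous_lowLine.continuousAt.eventually_lt continuous_hump.continuousAt
        (lowLine_lt_hump h)] with w hw hlt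
    rw [band, if_pos hw.le, max_eq_right hlt.le, ite_self]
  · rcases lt_trichotomy z.im 1 with h' | h' | h'
    · refine (harmonicSupportAt_hump z).congr ?_
      filter_upwards [eventually_lt_im h, eventually_im_lt h'] with w hw hw'
      rw [band, if_neg hw.not_gt, if_pos hw'.le]
    · refine (harmonicSupportAt_hump z).congr ?_
      filter_upwards [eventually_lt_im h,
        continuous_highLine.continuousAt.eventually_lt continuous_hump.continuousAt
          (highLine_lt_hump h')] with w hw hlt
      rw [band, if_neg hw.not_gt, max_eq_left hlt.le, ite_self]
    · refine ((harmonicSupportAt_hump z).max (harmonicSupportAt_highLine z)).congr ?_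
      filter_upwards [eventually_lt_im h, eventually_lt_im h'] with w hw hw'
      rw [band, if_neg hw.not_gt, if_neg hw'.not_ge]

theorem band_eventuallyEq_lowLine {z : ℂ} (hz : z.im = 2 / 3) : band =ᶠ[𝓝 z] lowLine := by
  filter_upwards [eventually_im_lt (hz.trans_lt (by norm_num : (2 / 3 : ℝ) < 5 / 6)),
    continuous_hump.continuousAt.eventually_lt continuous_lowLine.continuousAt
      (hump_lt_lowLine hz)] with w hw hlt
  rw [band, if_pos hw, max_eq_left hlt.le]

theorem band_eventuallyEq_highLine {z : ℂ} (hz : z.im = 4 / 3) : band =ᶠ[𝓝 z] highLine := by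
  filter_upwards [eventually_lt_im ((by norm_num : (1 : ℝ) < 4 / 3).trans_eq hz.symm),
    continuous_hump.continuousAt.eventually_lt continuous_highLine.continuousAt
      (hump_lt_highLine hz)] with w hw hlt
  rw [band, if_neg (by linarith), if_neg hw.not_ge, max_eq_right hlt.le]

theorem abs_band_le {z : ℂ} (h0 : 0 ≤ z.im) (h1 : z.im ≤ 4 / 3) : |band z| ≤ 35 * growth := by
  have hg := growth_gt
  have h2 : |hump z| ≤ 35 * growth := (abs_hump_le h0 h1).le.trans (by linarith)
  have h3 : |lowLine z| ≤ 35 * growth := by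
    rw [abs_le]; simp only [lowLine]; constructor <;> linarith
  have h4 : |highLine z| ≤ 35 * growth := by
    rw [highLine, abs_mul, abs_of_pos growth_pos, mul_comm]
    refine mul_le_mul_of_nonneg_right ?_ growth_pos.le
    rw [abs_le]; constructor <;> linarith
  unfold band
  split_ifs
  · exact abs_max_le_max_abs_abs.trans (max_le h3 h2)
  · exact h2
  · exact abs_max_le_max_abs_abs.trans (max_le h2 h4)

/-! ### Extension to the upper half-plane by scaling. -/

/-- Approximations of the half of the self-similar function carried by the upper half-plane: the
scaling is applied `n` times. -/
noncomputable def halfApprox : ℕ → ℂ → ℝ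
  | 0, z => if z.im < 2 / 3 then max 0 (lowLine z) else band z
  | n + 1, z => if z.im < 2 / 3 then growth⁻¹ * halfApprox n (2 * z) else band z

theorem im_two_mul (z : ℂ) : (2 * z).im = 2 * z.im := by simp

theorem halfApprox_of_le {z : ℂ} (h : 2 / 3 ≤ z.im) (n : ℕ) : halfApprox n z = band z := by
  cases n <;> rw [halfApprox, if_neg h.not_gt]

theorem halfApprox_succ_of_lt {z : ℂ} (h : z.im < 2 / 3) (n : ℕ) :
    halfApprox (n + 1) z = growth⁻¹ * halfApprox n (2 * z) := by
  rw [halfApprox, if_pos h]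

theorem halfApprox_eq_zero {z : ℂ} (h : z.im ≤ 0) (n : ℕ) : halfApprox n z = 0 := by
  induction n generalizing z with
  | zero =>
    rw [halfApprox, if_pos (by linarith), max_eq_left]
    simp only [lowLine]; linarith
  | succ n ih =>
    rw [halfApprox_succ_of_lt (by linarith), ih (by rw [im_two_mul]; linarith), mul_zero]

/-- Scaling reduces a point with `Im z < 2/3` to `2 * z` one stage earlier. On the seam `Im z = 2/3`
both sides are `lowLine`, by `highLine_two_mul`. -/
theorem harmonicSupportAt_halfApprox {z : ℂ} (hz : z.im < 4 / 3) (n : ℕ) :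
    HarmonicSupportAt (halfApprox n) z := by
  induction n generalizing z with
  | zero =>
    rcases lt_trichotomy z.im (2 / 3) with h | h | h
    · have h0 : HarmonicSupportAt (fun _ => (0 : ℝ)) z :=
        (harmonicSupportAt_affine_im 0 0 z).congr (Eventually.of_forall fun w => by simp)
      refine (h0.max (harmonicSupportAt_lowLine z)).congr ?_
      filter_upwards [eventually_im_lt h] with w hw
      rw [halfApprox, if_pos hw]
    · refine (harmonicSupportAt_lowLine z).congr ?_
      -- `7/12` is the zero of `lowLine`; above it the maximum with `0` is inactive.
      filter_upwards [band_eventuallyEq_lowLine h,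
        eventually_lt_im ((by norm_num : (7 / 12 : ℝ) < 2 / 3).trans_eq h.symm)] with w hw hw'
      rw [halfApprox, hw, max_eq_right, ite_self]
      simp only [lowLine]; linarith
    · refine (harmonicSupportAt_band z).congr ?_
      filter_upwards [eventually_lt_im h] with w hw using halfApprox_of_le hw.le 0
  | succ n ih =>
    rcases lt_trichotomy z.im (2 / 3) with h | h | h
    · have h1 : AnalyticAt ℂ (fun w : ℂ => 2 * w) z := by fun_prop
      refine (((ih (z := 2 * z) (by rw [im_two_mul]; linarith)).comp h1).const_mul
        (inv_nonneg.2 growth_pos.le)).congr ?_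
      filter_upwards [eventually_im_lt h] with w hw using halfApprox_succ_of_lt hw n
    · refine (harmonicSupportAt_lowLine z).congr ?_
      have h2 : ContinuousAt (fun w : ℂ => 2 * w) z := by fun_prop
      filter_upwards [band_eventuallyEq_lowLine h,
        h2.eventually (band_eventuallyEq_highLine (z := 2 * z) (by rw [im_two_mul, h]; norm_num)),
        eventually_lt_im ((by norm_num : (1 / 3 : ℝ) < 2 / 3).trans_eq h.symm)] with w hw hw' hw2
      rcases lt_or_ge w.im (2 / 3) with hlt | hge
      · rw [halfApprox_succ_of_lt hlt, halfApprox_of_le (by rw [im_two_mul]; linarith), hw',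
          highLine_two_mul, inv_mul_cancel_left₀ growth_pos.ne']
      · rw [halfApprox_of_le hge, hw]
    · refine (harmonicSupportAt_band z).congr ?_
      filter_upwards [eventually_lt_im h] with w hw using halfApprox_of_le hw.le _

theorem halfApprox_add_int (n : ℕ) (z : ℂ) (k : ℤ) : halfApprox n (z + k) = halfApprox n z := by
  induction n generalizing z k with
  | zero => simp [halfApprox, band_add_int, lowLine]
  | succ n ih =>
    have h : (2 : ℂ) * (z + k) = 2 * z + ((2 * k : ℤ) : ℂ) := by push_cast; ring
    rw [halfApprox, halfApprox, h, ih, band_add_int]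
    simp

theorem abs_halfApprox_le {z : ℂ} (hz : z.im < 4 / 3) (n : ℕ) :
    |halfApprox n z| ≤ 35 * growth := by
  have hg := growth_gt
  induction n generalizing z with
  | zero =>
    rcases lt_or_ge z.im (2 / 3) with h | h
    · rw [halfApprox, if_pos h, abs_of_nonneg (le_max_left _ _)]
      refine max_le (by linarith) ?_
      simp only [lowLine]; linarith
    · rw [halfApprox_of_le h]
      exact abs_band_le (by linarith) hz.le
  | succ n ih =>
    rcases lt_or_ge z.im (2 / 3) with h | h
    · rw [halfApprox_succ_of_lt h, abs_mul, abs_of_pos (inv_pos.2 growth_pos)]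
      refine (mul_le_of_le_one_left (abs_nonneg _) (inv_le_one_of_one_le₀ (by linarith))).trans
        (ih ?_)
      rw [im_two_mul]; linarith
    · rw [halfApprox_of_le h]
      exact abs_band_le (by linarith) hz.le

theorem halfApprox_succ_eq {z : ℂ} {n : ℕ} (h : 2 / 3 ≤ 2 ^ n * z.im) :
    halfApprox (n + 1) z = halfApprox n z := by
  induction n generalizing z with
  | zero =>
    rw [pow_zero, one_mul] at h
    rw [halfApprox_of_le h, halfApprox_of_le h]
  | succ n ih =>
    rcases lt_or_ge z.im (2 / 3) with h' | h'
    · rw [halfApprox_succ_of_lt h', halfApprox_succ_of_lt h', ih]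
      rw [im_two_mul]
      calc _ ≤ _ := h
        _ = _ := by ring
    · rw [halfApprox_of_le h', halfApprox_of_le h']

theorem halfApprox_eq_of_le {z : ℂ} {n m : ℕ} (h : 2 / 3 ≤ 2 ^ n * z.im) (hnm : n ≤ m) :
    halfApprox m z = halfApprox n z := by
  induction m, hnm using Nat.le_induction with
  | base => rfl
  | succ m hnm ih =>
    rw [← ih, halfApprox_succ_eq]
    have hpos : 0 < z.im := by
      by_contra! hneg
      have : 2 ^ n * z.im ≤ 0 := mul_nonpos_of_nonneg_of_nonpos (by positivity) hneg
      linarith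
    exact h.trans (mul_le_mul_of_nonneg_right
      (pow_le_pow_right₀ (by norm_num) hnm) hpos.le)

/-- The half of the self-similar function carried by the upper half-plane. -/
noncomputable def halfLimit (z : ℂ) : ℝ := halfApprox ⌈1 / z.im⌉₊ z

/-- The stages stabilise once `2ⁿ Im z ≥ 2/3`; the ceiling in `halfLimit` is merely one sufficient
exponent. -/
theorem two_thirds_le_of_ceil {z : ℂ} (hz : 0 < z.im) : 2 / 3 ≤ 2 ^ ⌈1 / z.im⌉₊ * z.im := by
  have h1 : 1 / z.im ≤ ⌈1 / z.im⌉₊ := Nat.le_ceil _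
  have h2 : ((⌈1 / z.im⌉₊ : ℕ) : ℝ) < 2 ^ ⌈1 / z.im⌉₊ := by exact_mod_cast Nat.lt_two_pow_self
  have h3 := (div_le_iff₀ hz).1 (h1.trans h2.le)
  linarith

theorem halfLimit_eq {z : ℂ} {n : ℕ} (h : 2 / 3 ≤ 2 ^ n * z.im) : halfLimit z = halfApprox n z := by
  have hpos : 0 < z.im := by
    by_contra! hneg
    have : 2 ^ n * z.im ≤ 0 := mul_nonpos_of_nonneg_of_nonpos (by positivity) hneg
    linarith
  rw [halfLimit, ← halfApprox_eq_of_le (two_thirds_le_of_ceil hpos) (le_max_left _ n),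
    halfApprox_eq_of_le h (le_max_right _ _)]

theorem halfLimit_of_le {z : ℂ} (h : 2 / 3 ≤ z.im) : halfLimit z = band z :=
  halfApprox_of_le h _

theorem halfLimit_eq_zero {z : ℂ} (h : z.im ≤ 0) : halfLimit z = 0 := halfApprox_eq_zero h _

theorem halfLimit_of_lt {z : ℂ} (h : z.im < 2 / 3) :
    halfLimit z = growth⁻¹ * halfLimit (2 * z) := by
  rcases le_or_gt z.im 0 with h0 | h0
  · rw [halfLimit_eq_zero h0, halfLimit_eq_zero (by rw [im_two_mul]; linarith), mul_zero]
  · have h1 := two_thirds_le_of_ceil h0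
    rw [halfLimit_eq (n := ⌈1 / z.im⌉₊) (z := 2 * z) (by rw [im_two_mul]; linarith),
      ← halfApprox_succ_of_lt h, halfLimit_eq (n := ⌈1 / z.im⌉₊ + 1)]
    rw [pow_succ]; linarith

theorem halfLimit_add_int (z : ℂ) (k : ℤ) : halfLimit (z + k) = halfLimit z := by
  simp [halfLimit, halfApprox_add_int]

theorem abs_halfLimit_le {z : ℂ} (hz : z.im < 4 / 3) : |halfLimit z| ≤ 35 * growth :=
  abs_halfApprox_le hz _

/-- Each scaling multiplies the error by `growth⁻¹`, and there is no error in the fundamental band.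
-/
theorem abs_halfApprox_sub_halfLimit_le {z : ℂ} (hz : z.im < 4 / 3) (n : ℕ) :
    |halfApprox n z - halfLimit z| ≤ 70 * growth * growth⁻¹ ^ n := by
  induction n generalizing z with
  | zero =>
    have h1 := abs_halfApprox_le hz 0
    have h2 := abs_halfLimit_le hz
    refine (abs_sub _ _).trans ?_
    rw [pow_zero]; linarith
  | succ n ih =>
    rcases lt_or_ge z.im (2 / 3) with h | h
    · rw [halfApprox_succ_of_lt h, halfLimit_of_lt h, ← mul_sub, abs_mul,
        abs_of_pos (inv_pos.2 growth_pos), pow_succ', mul_left_comm]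
      exact mul_le_mul_of_nonneg_left (ih (by rw [im_two_mul]; linarith))
        (inv_pos.2 growth_pos).le
    · rw [halfApprox_of_le h, halfLimit_of_le h, sub_self, abs_zero]
      have := growth_pos
      positivity

/-! ### The self-similar function on the strip. -/

/-- The self-similar subharmonic function on the strip. -/
noncomputable def selfSimilarFun (z : ℂ) : ℝ := halfLimit z + halfLimit (-z)

/-- Continuous subharmonic approximations of `selfSimilarFun`. -/
noncomputable def selfSimilarApprox (n : ℕ) (z : ℂ) : ℝ := halfApprox n z + halfApprox n (-z)

theorem im_lt_of_mem_strip {z : ℂ} (hz : z ∈ strip) : z.im < 4 / 3 ∧ (-z).im < 4 / 3 := by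
  have := abs_lt.1 (show |z.im| < 4 / 3 from hz)
  rw [Complex.neg_im]
  constructor <;> linarith

theorem isOpen_strip : IsOpen strip :=
  isOpen_lt (continuous_abs.comp Complex.continuous_im) continuous_const

theorem harmonicSupportAt_selfSimilarApprox (n : ℕ) {z : ℂ} (hz : z ∈ strip) :
    HarmonicSupportAt (selfSimilarApprox n) z := by
  have h : AnalyticAt ℂ (fun w : ℂ => -w) z := by fun_prop
  exact (harmonicSupportAt_halfApprox (im_lt_of_mem_strip hz).1 n).add
    ((harmonicSupportAt_halfApprox (im_lt_of_mem_strip hz).2 n).comp h)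

theorem abs_selfSimilarApprox_sub_le (n : ℕ) {z : ℂ} (hz : z ∈ strip) :
    |selfSimilarFun z - selfSimilarApprox n z| ≤ 140 * growth * growth⁻¹ ^ n := by
  have h1 := abs_halfApprox_sub_halfLimit_le (im_lt_of_mem_strip hz).1 n
  have h2 := abs_halfApprox_sub_halfLimit_le (im_lt_of_mem_strip hz).2 n
  rw [abs_le] at *
  simp only [selfSimilarFun, selfSimilarApprox]
  constructor <;> linarith

theorem tendsto_geometric_growth :
    Tendsto (fun n : ℕ => 140 * growth * growth⁻¹ ^ n) atTop (𝓝 0) := by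
  have := tendsto_pow_atTop_nhds_zero_of_lt_one (inv_nonneg.2 growth_pos.le)
    (inv_lt_one_of_one_lt₀ (by linarith [growth_gt]))
  simpa using this.const_mul (140 * growth)

theorem tendstoUniformlyOn_selfSimilarApprox :
    TendstoUniformlyOn selfSimilarApprox selfSimilarFun atTop strip := by
  rw [Metric.tendstoUniformlyOn_iff]
  intro δ hδ
  filter_upwards [tendsto_geometric_growth.eventually (gt_mem_nhds hδ)] with n hn z hz
  exact (abs_selfSimilarApprox_sub_le n hz).trans_lt hn

theorem continuousOn_selfSimilarApprox (n : ℕ) : ContinuousOn (selfSimilarApprox n) strip :=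
  fun _ hz => (harmonicSupportAt_selfSimilarApprox n hz).continuousAt.continuousWithinAt

theorem continuousOn_selfSimilarFun : ContinuousOn selfSimilarFun strip :=
  tendstoUniformlyOn_selfSimilarApprox.continuousOn
    (Eventually.of_forall continuousOn_selfSimilarApprox).frequently

theorem isSubharmonicOn_selfSimilarFun : IsSubharmonicOn selfSimilarFun strip :=
  .of_tendstoUniformlyOn (fun n => HarmonicSupportAt.isSubharmonicOn
    fun _ hz => harmonicSupportAt_selfSimilarApprox n hz) continuousOn_selfSimilarApprox
    tendstoUniformlyOn_selfSimilarApprox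

theorem abs_selfSimilarFun_le {z : ℂ} (hz : z ∈ strip) : |selfSimilarFun z| ≤ 70 * growth := by
  have h1 := abs_halfLimit_le (im_lt_of_mem_strip hz).1
  have h2 := abs_halfLimit_le (im_lt_of_mem_strip hz).2
  rw [abs_le] at *
  simp only [selfSimilarFun]
  constructor <;> linarith

theorem selfSimilarFun_half {z : ℂ} (hz : z ∈ strip) :
    selfSimilarFun (z / 2) = growth⁻¹ * selfSimilarFun z := by
  obtain ⟨h1, h2⟩ := im_lt_of_mem_strip hz
  have e1 : (2 : ℂ) * (z / 2) = z := by ring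
  have e2 : (2 : ℂ) * (-(z / 2)) = -z := by ring
  have h3 : (z / 2).im < 2 / 3 := by
    have := congrArg Complex.im e1; rw [im_two_mul] at this; linarith
  have h4 : (-(z / 2)).im < 2 / 3 := by
    have := congrArg Complex.im e2; rw [im_two_mul] at this; linarith
  rw [selfSimilarFun, halfLimit_of_lt h3, halfLimit_of_lt h4, e1, e2, selfSimilarFun, mul_add]

theorem selfSimilarFun_add_int (z : ℂ) (k : ℤ) :
    selfSimilarFun (z + k) = selfSimilarFun z := by
  have : -(z + (k : ℂ)) = -z + ((-k : ℤ) : ℂ) := by push_cast; ring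
  rw [selfSimilarFun, this, halfLimit_add_int, halfLimit_add_int, selfSimilarFun]

theorem im_div_two_pow (z : ℂ) (n : ℕ) : (z / 2 ^ n).im = z.im / 2 ^ n := by
  have : (2 : ℂ) ^ n = ((2 ^ n : ℝ) : ℂ) := by push_cast; rfl
  rw [this, Complex.div_ofReal_im]

theorem im_two_pow_mul (z : ℂ) (n : ℕ) : (2 ^ n * z).im = 2 ^ n * z.im := by
  have : (2 : ℂ) ^ n = ((2 ^ n : ℝ) : ℂ) := by push_cast; rfl
  rw [this, Complex.im_ofReal_mul]

theorem div_two_pow_mem_strip {z : ℂ} (hz : z ∈ strip) (n : ℕ) : z / 2 ^ n ∈ strip := by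
  change |(z / 2 ^ n).im| < 4 / 3
  rw [im_div_two_pow, abs_div, abs_of_pos (by positivity : (0 : ℝ) < 2 ^ n)]
  exact (div_le_self (abs_nonneg _) (one_le_pow₀ (by norm_num))).trans_lt hz

theorem selfSimilarFun_div_two_pow {z : ℂ} (hz : z ∈ strip) (n : ℕ) :
    selfSimilarFun (z / 2 ^ n) = (growth ^ n)⁻¹ * selfSimilarFun z := by
  induction n with
  | zero => simp
  | succ n ih =>
    rw [pow_succ, ← div_div, selfSimilarFun_half (div_two_pow_mem_strip hz n), ih, pow_succ,
      mul_inv]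
    ring

theorem im_add_int (z : ℂ) (k : ℤ) : (z + k).im = z.im := by simp

theorem add_int_mem_strip {z : ℂ} (hz : z ∈ strip) (k : ℤ) : z + k ∈ strip := by
  change |(z + k).im| < 4 / 3
  rw [im_add_int]; exact hz

theorem selfSimilarFun_dyadicMap (n : ℕ) (k : ℤ) {z : ℂ} (hz : z ∈ strip) :
    selfSimilarFun (dyadicMap n k z) = (growth ^ n)⁻¹ * selfSimilarFun z := by
  rw [dyadicMap, selfSimilarFun_div_two_pow (add_int_mem_strip hz k), selfSimilarFun_add_int]

theorem selfSimilarFun_eq_halfLimit {z : ℂ} (hz : 0 ≤ z.im) : selfSimilarFun z = halfLimit z := by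
  rw [selfSimilarFun, halfLimit_eq_zero (z := -z) (by simpa using hz), add_zero]

theorem selfSimilarFun_neg (z : ℂ) : selfSimilarFun (-z) = selfSimilarFun z := by
  rw [selfSimilarFun, selfSimilarFun, neg_neg, add_comm]

theorem selfSimilarFun_pos {z : ℂ} (hz : |z.im| = 2 / 3) : 0 < selfSimilarFun z := by
  wlog h : 0 ≤ z.im generalizing z
  · rw [← selfSimilarFun_neg]
    exact this (by rwa [Complex.neg_im, abs_neg]) (by rw [Complex.neg_im]; linarith)
  rw [abs_of_nonneg h] at hz
  rw [selfSimilarFun_eq_halfLimit h, halfLimit_of_le hz.ge,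
    (band_eventuallyEq_lowLine hz).eq_of_nhds, lowLine, hz]
  norm_num

/-- This germ at the edges of the strip is the same for all `n`; the gluing along the imaginary axis
of the annulus uses it. -/
theorem selfSimilarApprox_eventuallyEq (n : ℕ) {z : ℂ} (hz : |z.im| = 4 / 3) :
    selfSimilarApprox n =ᶠ[𝓝 z] fun w => growth * (30 * |w.im| - 35) := by
  wlog h : 0 ≤ z.im generalizing z
  · have h1 : ContinuousAt (fun w : ℂ => -w) z := by fun_prop
    filter_upwards [h1.eventually (this (z := -z) (by rwa [Complex.neg_im, abs_neg])
      (by rw [Complex.neg_im]; linarith))] with w hw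
    rw [Complex.neg_im, abs_neg] at hw
    rw [← hw, selfSimilarApprox, selfSimilarApprox, neg_neg, add_comm]
  rw [abs_of_nonneg h] at hz
  filter_upwards [band_eventuallyEq_highLine hz,
    eventually_lt_im ((by norm_num : (2 / 3 : ℝ) < 4 / 3).trans_eq hz.symm)] with w hw hw'
  rw [selfSimilarApprox, halfApprox_of_le hw'.le,
    halfApprox_eq_zero (z := -w) (by rw [Complex.neg_im]; linarith), hw, add_zero, highLine,
    abs_of_nonneg (by linarith)]

/-! ### Wells and the components of the negativity set. -/

/-- The negativity set of the self-similar function in the fundamental bands. -/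
def wells : Set ℂ := {z | (z ∈ strip ∧ selfSimilarFun z < 0) ∧ 2 / 3 < |z.im|}

theorem isOpen_negative : IsOpen {z | z ∈ strip ∧ selfSimilarFun z < 0} :=
  continuousOn_selfSimilarFun.isOpen_inter_preimage isOpen_strip isOpen_Iio

theorem mem_dyadicLevel_wells {n : ℕ} {z : ℂ} :
    z ∈ dyadicLevel wells n ↔ (z ∈ strip ∧ selfSimilarFun z < 0) ∧
      2 / 3 < 2 ^ n * |z.im| ∧ 2 ^ n * |z.im| < 4 / 3 := by
  have hM : 0 < (growth ^ n)⁻¹ := inv_pos.2 (pow_pos growth_pos n)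
  have h2 : (0 : ℝ) < 2 ^ n := by positivity
  constructor
  · intro h
    obtain ⟨k, w, ⟨⟨hw, hneg⟩, him⟩, rfl⟩ := mem_iUnion.1 h
    have himd : 2 ^ n * |(dyadicMap n k w).im| = |w.im| := by
      rw [dyadicMap, im_div_two_pow, im_add_int, abs_div, abs_of_pos h2, mul_div_cancel₀ _ h2.ne']
    refine ⟨⟨div_two_pow_mem_strip (add_int_mem_strip hw k) n, ?_⟩, ?_⟩
    · rw [selfSimilarFun_dyadicMap n k hw]
      exact mul_neg_of_pos_of_neg hM hneg
    · rw [himd]; exact ⟨him, hw⟩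
  · rintro ⟨⟨hz, hneg⟩, h1, h3⟩
    have hc : (2 : ℂ) ^ n ≠ 0 := pow_ne_zero n two_ne_zero
    have habs : |(2 ^ n * z).im| = 2 ^ n * |z.im| := by
      rw [im_two_pow_mul, abs_mul, abs_of_pos h2]
    have hw : 2 ^ n * z ∈ strip := by
      change |(2 ^ n * z).im| < 4 / 3
      rwa [habs]
    have hdm : dyadicMap n 0 (2 ^ n * z) = z := by
      rw [dyadicMap, Int.cast_zero, add_zero, mul_div_cancel_left₀ _ hc]
    refine mem_iUnion.2 ⟨0, 2 ^ n * z, ⟨⟨hw, ?_⟩, by rwa [habs]⟩, hdm⟩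
    have := selfSimilarFun_dyadicMap n 0 hw
    rw [hdm] at this
    by_contra! hge
    exact absurd (this ▸ hneg) (mul_nonneg hM.le hge).not_gt

theorem isOpen_dyadicLevel_wells (n : ℕ) : IsOpen (dyadicLevel wells n) := by
  have h : dyadicLevel wells n = {z | z ∈ strip ∧ selfSimilarFun z < 0} ∩
      {z | 2 / 3 < 2 ^ n * |z.im| ∧ 2 ^ n * |z.im| < 4 / 3} := by
    ext z; exact mem_dyadicLevel_wells
  have hc : Continuous fun z : ℂ => 2 ^ n * |z.im| :=
    continuous_const.mul (continuous_abs.comp Complex.continuous_im)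
  rw [h]
  exact isOpen_negative.inter ((isOpen_lt continuous_const hc).inter (isOpen_lt hc continuous_const))

/-- These lines are the barriers between consecutive levels of wells. -/
theorem selfSimilarFun_pos_of_scaled {z : ℂ} {n : ℕ} (h : 2 ^ n * |z.im| = 2 / 3) :
    0 < selfSimilarFun z := by
  have h2 : (0 : ℝ) < 2 ^ n := by positivity
  have habs : |(2 ^ n * z).im| = 2 / 3 := by
    rw [im_two_pow_mul, abs_mul, abs_of_pos h2, h]
  have hw : 2 ^ n * z ∈ strip := by
    change |(2 ^ n * z).im| < 4 / 3
    rw [habs]; norm_num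
  have := selfSimilarFun_div_two_pow hw n
  rw [mul_div_cancel_left₀ _ (pow_ne_zero n two_ne_zero)] at this
  rw [this]
  exact mul_pos (inv_pos.2 (pow_pos growth_pos n)) (selfSimilarFun_pos habs)

theorem negative_inter_closure_dyadicLevel_wells (n : ℕ) :
    {z | z ∈ strip ∧ selfSimilarFun z < 0} ∩ closure (dyadicLevel wells n)
      ⊆ dyadicLevel wells n := by
  rintro z ⟨⟨hz, hneg⟩, hcl⟩
  have hc : Continuous fun z : ℂ => 2 ^ n * |z.im| :=
    continuous_const.mul (continuous_abs.comp Complex.continuous_im)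
  have hclosed : IsClosed {z : ℂ | 2 / 3 ≤ 2 ^ n * |z.im| ∧ 2 ^ n * |z.im| ≤ 4 / 3} :=
    (isClosed_le continuous_const hc).inter (isClosed_le hc continuous_const)
  have hmem : z ∈ {z : ℂ | 2 / 3 ≤ 2 ^ n * |z.im| ∧ 2 ^ n * |z.im| ≤ 4 / 3} := by
    refine closure_minimal (fun w hw => ?_) hclosed hcl
    obtain ⟨_, h1, h2⟩ := mem_dyadicLevel_wells.1 hw
    exact ⟨h1.le, h2.le⟩
  refine mem_dyadicLevel_wells.2 ⟨⟨hz, hneg⟩, lt_of_le_of_ne hmem.1 fun h => ?_,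
    lt_of_le_of_ne hmem.2 fun h => ?_⟩
  · exact (selfSimilarFun_pos_of_scaled h.symm).not_gt hneg
  -- The outer edge of level `0` is the boundary of the strip; that of level `n + 1` is the barrier
  -- below level `n`.
  · cases n with
    | zero =>
      rw [pow_zero, one_mul] at h
      exact (show |z.im| < 4 / 3 from hz).ne h
    | succ n =>
      refine (selfSimilarFun_pos_of_scaled (n := n) (z := z) ?_).not_gt hneg
      rw [pow_succ] at h; linarith

theorem isSelfSimilar_selfSimilarFun : IsSelfSimilar selfSimilarFun wells growth where
  isOpen := isOpen_negative.inter
    (isOpen_lt continuous_const (continuous_abs.comp Complex.continuous_im))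
  subset := fun _ hz => hz.1.1
  le_map := fun n k _ hz => (selfSimilarFun_dyadicMap n k hz).ge
  map_eq := fun n k _ hz => selfSimilarFun_dyadicMap n k hz.1.1
  components := fun n => isUnionOfComponents_of_isOpen
    (fun _ hz => (mem_dyadicLevel_wells.1 hz).1) (isOpen_dyadicLevel_wells n)
    (negative_inter_closure_dyadicLevel_wells n)

theorem disjoint_dyadicLevel_wells {m n : ℕ} (hmn : m ≠ n) :
    Disjoint (dyadicLevel wells m) (dyadicLevel wells n) := by
  wlog h : m < n generalizing m n
  · exact (this hmn.symm (lt_of_le_of_ne (not_lt.1 h) hmn.symm)).symm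
  rw [Set.disjoint_left]
  intro z hm hn
  have h1 := (mem_dyadicLevel_wells.1 hm).2.1
  have h2 := (mem_dyadicLevel_wells.1 hn).2.2
  have h3 : (2 : ℝ) ^ (m + 1) ≤ 2 ^ n := pow_le_pow_right₀ (by norm_num) h
  have h4 := mul_le_mul_of_nonneg_right h3 (abs_nonneg z.im)
  rw [pow_succ] at h4
  linarith

/-- Every vertical line meets the wells in a segment of fixed length, in the upper or in the lower
half-plane. -/
theorem exists_sign_selfSimilarFun_le (x : ℝ) :
    ∃ s : ℝ, |s| = 1 ∧ ∀ y : ℝ, 1 - 1 / (20 * Real.pi) ≤ y → y ≤ 1 →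
      selfSimilarFun (x + (s * y : ℝ) * Complex.I) ≤ -60 := by
  have hpi := Real.pi_gt_three
  have hinv : 1 / (20 * Real.pi) < 1 / 6 := one_div_lt_one_div_of_lt (by norm_num) (by linarith)
  have him : ∀ x y : ℝ, (wave (x + y * Complex.I)).im
      = Real.exp (10 * Real.pi * (y - 1)) * -Real.sin (10 * Real.pi * x) := by
    intro x y
    have : -(10 * Real.pi) * (Complex.I * (x + y * Complex.I) + 1)
        = ((10 * Real.pi * (y - 1) : ℝ) : ℂ) + ((-(10 * Real.pi * x) : ℝ) : ℂ) * Complex.I := by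
      push_cast
      linear_combination (-10 * Real.pi * y) * Complex.I_mul_I
    rw [wave, this, Complex.exp_im]
    simp [Real.sin_neg]
  have key : ∀ x y : ℝ, 0 ≤ Real.sin (10 * Real.pi * x) → 1 - 1 / (20 * Real.pi) ≤ y → y ≤ 1 →
      selfSimilarFun (x + y * Complex.I) ≤ -60 := by
    intro x y hx h1 h2
    have hy : ((x : ℂ) + y * Complex.I).im = y := by simp
    rw [selfSimilarFun_eq_halfLimit (by rw [hy]; linarith),
      halfLimit_of_le (by rw [hy]; linarith), band, if_neg (by rw [hy]; linarith),
      if_pos (by rw [hy]; exact h2)]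
    refine hump_le_of_wave ?_ (by rw [hy]; exact h1) (by rw [hy]; exact h2)
    rw [him, mul_neg]
    exact neg_nonpos.2 (mul_nonneg (Real.exp_pos _).le hx)
  rcases le_total 0 (Real.sin (10 * Real.pi * x)) with h | h
  · exact ⟨1, by simp, fun y h1 h2 => by simpa using key x y h h1 h2⟩
  -- The half-turn replaces `x` by `-x` and so reverses the sign of the sine; conjugation would not.
  · refine ⟨-1, by simp, fun y h1 h2 => ?_⟩
    have := key (-x) y (by rw [mul_neg, Real.sin_neg]; linarith) h1 h2
    rw [← selfSimilarFun_neg] at this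
    convert this using 2
    push_cast; ring

/-! ### Transplantation to the annulus, with `ε = π / 2`. -/

/-- The coordinate on the right half-plane in which it becomes the strip `|Im z| < 4/3`. -/
noncomputable def logCoord (ζ : ℂ) : ℂ := (8 / (3 * Real.pi) : ℝ) * Complex.log ζ

/-- The inverse of `logCoord` on the strip. -/
noncomputable def sectorMap (z : ℂ) : ℂ := Complex.exp ((3 * (Real.pi / 2) / 4 : ℝ) * z)

theorem logCoord_im (ζ : ℂ) : (logCoord ζ).im = 8 / (3 * Real.pi) * ζ.arg := by
  rw [logCoord, Complex.im_ofReal_mul, Complex.log_im]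

theorem mul_logCoord (ζ : ℂ) : ((3 * (Real.pi / 2) / 4 : ℝ) : ℂ) * logCoord ζ = Complex.log ζ := by
  have hpi := Real.pi_ne_zero
  rw [logCoord, ← mul_assoc, ← Complex.ofReal_mul]
  have : 3 * (Real.pi / 2) / 4 * (8 / (3 * Real.pi)) = 1 := by field_simp; norm_num
  rw [this, Complex.ofReal_one, one_mul]

theorem sectorMap_logCoord {ζ : ℂ} (h : ζ ≠ 0) : sectorMap (logCoord ζ) = ζ := by
  rw [sectorMap, mul_logCoord, Complex.exp_log h]

theorem abs_im_lt_of_mem_strip {z : ℂ} (hz : z ∈ strip) :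
    |(((3 * (Real.pi / 2) / 4 : ℝ) : ℂ) * z).im| < Real.pi / 2 := by
  have hpi := Real.pi_pos
  have hz' : |z.im| < 4 / 3 := hz
  rw [Complex.im_ofReal_mul, abs_mul, abs_of_pos (by positivity)]
  nlinarith

theorem logCoord_sectorMap {z : ℂ} (hz : z ∈ strip) : logCoord (sectorMap z) = z := by
  have hpi := Real.pi_pos
  have h := abs_lt.1 (abs_im_lt_of_mem_strip hz)
  have hne : ((3 * (Real.pi / 2) / 4 : ℝ) : ℂ) ≠ 0 := by
    exact_mod_cast (by positivity : (3 * (Real.pi / 2) / 4 : ℝ) ≠ 0)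
  apply mul_left_cancel₀ hne
  rw [mul_logCoord, sectorMap, Complex.log_exp (by linarith) (by linarith)]

theorem sectorMap_re_pos {z : ℂ} (hz : z ∈ strip) : 0 < (sectorMap z).re := by
  rw [sectorMap, Complex.exp_re]
  exact mul_pos (Real.exp_pos _) (Real.cos_pos_of_mem_Ioo (abs_lt.1 (abs_im_lt_of_mem_strip hz)))

theorem ne_zero_of_re_pos {ζ : ℂ} (h : 0 < ζ.re) : ζ ≠ 0 := fun h' => by simp [h'] at h

theorem logCoord_mem_strip {ζ : ℂ} (h : 0 < ζ.re) : logCoord ζ ∈ strip := by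
  have hpi := Real.pi_pos
  change |(logCoord ζ).im| < 4 / 3
  have h1 : |ζ.arg| < Real.pi / 2 := Complex.abs_arg_lt_pi_div_two_iff.2 (Or.inl h)
  rw [logCoord_im, abs_mul, abs_of_pos (by positivity)]
  calc 8 / (3 * Real.pi) * |ζ.arg| < 8 / (3 * Real.pi) * (Real.pi / 2) :=
        mul_lt_mul_of_pos_left h1 (by positivity)
    _ = 4 / 3 := by field_simp; norm_num

theorem analyticAt_logCoord {ζ : ℂ} (h : ζ ∈ Complex.slitPlane) : AnalyticAt ℂ logCoord ζ := by
  unfold logCoord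
  exact analyticAt_const.mul (analyticAt_clog h)

theorem mem_slitPlane_of_re_pos {ζ : ℂ} (h : 0 < ζ.re) : ζ ∈ Complex.slitPlane := Or.inl h

/-- A function on the strip is transplanted to the right half-plane and continued linearly to the
left half-plane. -/
noncomputable def transplant (f : ℂ → ℝ) (ζ : ℂ) : ℝ :=
  if 0 < ζ.re then f (logCoord ζ) else 5 * growth - 40 * growth * ζ.re

theorem transplant_of_pos (f : ℂ → ℝ) {ζ : ℂ} (h : 0 < ζ.re) :
    transplant f ζ = f (logCoord ζ) := if_pos h

theorem transplant_of_nonpos (f : ℂ → ℝ) {ζ : ℂ} (h : ζ.re ≤ 0) :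
    transplant f ζ = 5 * growth - 40 * growth * ζ.re := if_neg h.not_gt

theorem eventually_re_pos {ζ : ℂ} (h : 0 < ζ.re) : ∀ᶠ w : ℂ in 𝓝 ζ, 0 < w.re :=
  continuousAt_const.eventually_lt Complex.continuous_re.continuousAt h

theorem harmonicSupportAt_linear (ζ : ℂ) :
    HarmonicSupportAt (fun w => 5 * growth - 40 * growth * w.re) ζ := by
  have h : Differentiable ℂ fun w : ℂ => (5 * growth : ℝ) - ((40 * growth : ℝ) : ℂ) * w := by
    fun_prop
  refine (HarmonicSupportAt.of_analyticAt (h.analyticAt ζ)).congr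
    (Eventually.of_forall fun w => ?_)
  simp only [Complex.sub_re, Complex.ofReal_re, Complex.re_ofReal_mul]

/-- The logarithmic continuation `M (80 |arg ζ| / π - 35)` lies above the linear one in the right
half-plane. -/
theorem linear_le_arg {ζ : ℂ} (h1 : 1 < ‖ζ‖) (h : 0 ≤ ζ.re) :
    5 * growth - 40 * growth * ζ.re ≤ growth * (30 * (8 / (3 * Real.pi) * |ζ.arg|) - 35) := by
  have hpi := Real.pi_pos
  have hg := growth_pos
  have harg : |ζ.arg| ≤ Real.pi / 2 := Complex.abs_arg_le_pi_div_two_iff.2 h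
  have hre : ζ.re = ‖ζ‖ * Real.cos |ζ.arg| := by
    rw [Real.cos_abs, Complex.norm_mul_cos_arg]
  -- The chord bound `cos t ≥ 1 - 2t/π` together with `‖ζ‖ > 1` gives the comparison, with equality
  -- of the two continuations on the imaginary axis.
  have hcos := Real.one_sub_mul_le_cos (abs_nonneg ζ.arg) harg
  have hc0 : 0 ≤ Real.cos |ζ.arg| := Real.cos_nonneg_of_mem_Icc
    ⟨by linarith [abs_nonneg ζ.arg], harg⟩
  have h2 : 1 - 2 / Real.pi * |ζ.arg| ≤ ζ.re := by
    rw [hre]; nlinarith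
  have h3 : growth * (30 * (8 / (3 * Real.pi) * |ζ.arg|) - 35)
      = 5 * growth - 40 * growth * (1 - 2 / Real.pi * |ζ.arg|) := by
    field_simp; ring
  rw [h3]
  nlinarith

/-- The same chord bound, applied to `π - |arg ζ|`, reverses the comparison. Across the imaginary
axis the piecewise function is thus a maximum. -/
theorem arg_le_linear {ζ : ℂ} (h1 : 1 < ‖ζ‖) (h : ζ.re ≤ 0) :
    growth * (30 * (8 / (3 * Real.pi) * |ζ.arg|) - 35) ≤ 5 * growth - 40 * growth * ζ.re := by
  have hpi := Real.pi_pos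
  have hg := growth_pos
  have harg : Real.pi / 2 ≤ |ζ.arg| := by
    by_contra! hlt
    rcases Complex.abs_arg_lt_pi_div_two_iff.1 hlt with h' | h'
    · exact absurd h' h.not_gt
    · rw [h', norm_zero] at h1; linarith
  have harg' := Complex.abs_arg_le_pi ζ
  have hre : ζ.re = -(‖ζ‖ * Real.cos (Real.pi - |ζ.arg|)) := by
    rw [Real.cos_pi_sub, Real.cos_abs, mul_neg, neg_neg, Complex.norm_mul_cos_arg]
  have hcos := Real.one_sub_mul_le_cos (x := Real.pi - |ζ.arg|) (by linarith) (by linarith)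
  have hc0 : 0 ≤ Real.cos (Real.pi - |ζ.arg|) := Real.cos_nonneg_of_mem_Icc
    ⟨by linarith, by linarith⟩
  have h4 : 1 - 2 / Real.pi * (Real.pi - |ζ.arg|) = -(1 - 2 / Real.pi * |ζ.arg|) := by
    field_simp; ring
  have h2 : ζ.re ≤ 1 - 2 / Real.pi * |ζ.arg| := by
    rw [hre]; rw [h4] at hcos; nlinarith
  have h3 : growth * (30 * (8 / (3 * Real.pi) * |ζ.arg|) - 35)
      = 5 * growth - 40 * growth * (1 - 2 / Real.pi * |ζ.arg|) := by
    field_simp; ring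
  rw [h3]
  nlinarith

theorem harmonicSupportAt_abs_arg {ζ : ℂ} (h : ζ.im ≠ 0) :
    HarmonicSupportAt (fun w => growth * (30 * (8 / (3 * Real.pi) * |w.arg|) - 35)) ζ := by
  have hg := growth_pos
  have hpi := Real.pi_pos
  have hlog := analyticAt_logCoord (ζ := ζ) (Or.inr h)
  have hc : ∀ s : ℝ, HarmonicSupportAt (fun w => growth * (30 * (s * (logCoord w).im) - 35)) ζ := by
    intro s
    refine ((harmonicSupportAt_affine_im (growth * 30 * s) (-(growth * 35)) _).comp hlog).congr
      (Eventually.of_forall fun w => ?_)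
    ring
  refine ((hc 1).max (hc (-1))).congr (Eventually.of_forall fun w => ?_)
  simp only [logCoord_im]
  rcases le_total 0 w.arg with h0 | h0
  · have : 0 ≤ growth * (8 / (3 * Real.pi) * w.arg) := by positivity
    rw [abs_of_nonneg h0, max_eq_left (by linarith), one_mul]
  · have : 0 ≤ growth * (8 / (3 * Real.pi) * -w.arg) :=
      mul_nonneg hg.le (mul_nonneg (by positivity) (by linarith))
    rw [abs_of_nonpos h0, max_eq_right (by linarith)]
    ring

theorem harmonicSupportAt_transplant {f : ℂ → ℝ} (hf : ∀ z ∈ strip, HarmonicSupportAt f z)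
    (hf' : ∀ z : ℂ, |z.im| = 4 / 3 → f =ᶠ[𝓝 z] fun w => growth * (30 * |w.im| - 35))
    {ζ : ℂ} (hζ : 1 < ‖ζ‖) : HarmonicSupportAt (transplant f) ζ := by
  have hpi := Real.pi_pos
  rcases lt_trichotomy ζ.re 0 with h | h | h
  · refine (harmonicSupportAt_linear ζ).congr ?_
    filter_upwards [Complex.continuous_re.continuousAt.eventually_lt continuousAt_const h]
      with w hw using transplant_of_nonpos f (le_of_lt hw)
  · have him : ζ.im ≠ 0 := by
      intro h'
      have : ζ = 0 := Complex.ext h h'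
      rw [this, norm_zero] at hζ; linarith
    have hne : ζ ≠ 0 := fun h' => him (by rw [h', Complex.zero_im])
    have hlog := (analyticAt_logCoord (ζ := ζ) (Or.inr him)).continuousAt
    have harg : |ζ.arg| = Real.pi / 2 := by
      refine le_antisymm (Complex.abs_arg_le_pi_div_two_iff.2 h.ge) ?_
      by_contra! hlt
      rcases Complex.abs_arg_lt_pi_div_two_iff.1 hlt with h' | h'
      · exact absurd h' h.not_gt
      · exact hne h'
    have hz : |(logCoord ζ).im| = 4 / 3 := by
      rw [logCoord_im, abs_mul, harg, abs_of_pos (by positivity)]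
      field_simp; norm_num
    refine ((harmonicSupportAt_linear ζ).max (harmonicSupportAt_abs_arg him)).congr ?_
    filter_upwards [hlog.eventually (hf' _ hz),
      continuousAt_const.eventually_lt continuous_norm.continuousAt hζ] with w hw hw1
    rcases lt_or_ge 0 w.re with h0 | h0
    · rw [transplant_of_pos f h0, hw, logCoord_im, abs_mul,
        abs_of_pos (by positivity : 0 < 8 / (3 * Real.pi)), max_eq_right (linear_le_arg hw1 h0.le)]
    · rw [transplant_of_nonpos f h0, max_eq_left (arg_le_linear hw1 h0)]
  · refine ((hf _ (logCoord_mem_strip h)).comp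
      (analyticAt_logCoord (mem_slitPlane_of_re_pos h))).congr ?_
    filter_upwards [eventually_re_pos h] with w hw using transplant_of_pos f hw

/-- The subharmonic function on the annulus. -/
noncomputable def annulusFun : ℂ → ℝ := transplant selfSimilarFun

theorem harmonicSupportAt_annulusApprox (n : ℕ) {ζ : ℂ} (hζ : ζ ∈ annulus) :
    HarmonicSupportAt (transplant (selfSimilarApprox n)) ζ :=
  harmonicSupportAt_transplant (fun _ hz => harmonicSupportAt_selfSimilarApprox n hz)
    (fun _ hz => selfSimilarApprox_eventuallyEq n hz) hζ.1

theorem continuousOn_annulusApprox (n : ℕ) :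
    ContinuousOn (transplant (selfSimilarApprox n)) annulus :=
  fun _ hζ => (harmonicSupportAt_annulusApprox n hζ).continuousAt.continuousWithinAt

theorem tendstoUniformlyOn_annulusApprox :
    TendstoUniformlyOn (fun n => transplant (selfSimilarApprox n)) annulusFun atTop annulus := by
  rw [Metric.tendstoUniformlyOn_iff]
  intro δ hδ
  filter_upwards [Metric.tendstoUniformlyOn_iff.1 tendstoUniformlyOn_selfSimilarApprox δ hδ]
    with n hn ζ _
  rcases lt_or_ge 0 ζ.re with h | h
  · rw [annulusFun, transplant_of_pos _ h, transplant_of_pos _ h]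
    exact hn _ (logCoord_mem_strip h)
  · rw [annulusFun, transplant_of_nonpos _ h, transplant_of_nonpos _ h, dist_self]
    exact hδ

theorem continuousOn_annulusFun : ContinuousOn annulusFun annulus :=
  tendstoUniformlyOn_annulusApprox.continuousOn
    (Eventually.of_forall continuousOn_annulusApprox).frequently

theorem isSubharmonicOn_annulusFun : IsSubharmonicOn annulusFun annulus :=
  .of_tendstoUniformlyOn (fun n => HarmonicSupportAt.isSubharmonicOn
    fun _ hζ => harmonicSupportAt_annulusApprox n hζ) continuousOn_annulusApprox
    tendstoUniformlyOn_annulusApprox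

theorem abs_annulusFun_le {ζ : ℂ} (hζ : ζ ∈ annulus) : |annulusFun ζ| ≤ 85 * growth := by
  have hg := growth_pos
  rcases lt_or_ge 0 ζ.re with h | h
  · rw [annulusFun, transplant_of_pos _ h]
    exact (abs_selfSimilarFun_le (logCoord_mem_strip h)).trans (by linarith)
  · rw [annulusFun, transplant_of_nonpos _ h]
    have h1 := abs_le.1 (Complex.abs_re_le_norm ζ)
    have h2 : -2 ≤ ζ.re := by linarith [hζ.2]
    rw [abs_le]
    constructor <;> nlinarith

/-! ### The sets in the annulus and the integrals over circles. -/

/-- The image in the annulus of the wells of level `n`. -/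
noncomputable def annulusLevel (n : ℕ) : Set ℂ := annulus ∩ sectorMap '' dyadicLevel wells n

theorem mem_annulusLevel {n : ℕ} {ζ : ℂ} :
    ζ ∈ annulusLevel n ↔ ζ ∈ annulus ∧ 0 < ζ.re ∧ logCoord ζ ∈ dyadicLevel wells n := by
  constructor
  · rintro ⟨hζ, z, hz, rfl⟩
    have hs := (mem_dyadicLevel_wells.1 hz).1.1
    exact ⟨hζ, sectorMap_re_pos hs, by rwa [logCoord_sectorMap hs]⟩
  · rintro ⟨hζ, hre, hz⟩
    exact ⟨hζ, _, hz, sectorMap_logCoord (ne_zero_of_re_pos hre)⟩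

theorem isOpen_annulus : IsOpen annulus :=
  (isOpen_lt continuous_const continuous_norm).inter (isOpen_lt continuous_norm continuous_const)

theorem isOpen_annulusLevel (n : ℕ) : IsOpen (annulusLevel n) := by
  rw [isOpen_iff_mem_nhds]
  intro ζ hζ
  obtain ⟨h1, h2, h3⟩ := mem_annulusLevel.1 hζ
  have hlog := (analyticAt_logCoord (mem_slitPlane_of_re_pos h2)).continuousAt
  filter_upwards [isOpen_annulus.mem_nhds h1, eventually_re_pos h2,
    hlog ((isOpen_dyadicLevel_wells n).mem_nhds h3)] with w hw1 hw2 hw3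
  exact mem_annulusLevel.2 ⟨hw1, hw2, hw3⟩

theorem annulusLevel_subset (n : ℕ) :
    annulusLevel n ⊆ {ζ | ζ ∈ annulus ∧ annulusFun ζ < 0} := by
  intro ζ hζ
  obtain ⟨h1, h2, h3⟩ := mem_annulusLevel.1 hζ
  refine ⟨h1, ?_⟩
  rw [annulusFun, transplant_of_pos _ h2]
  exact (mem_dyadicLevel_wells.1 h3).1.2

theorem isUnionOfComponents_annulusLevel (n : ℕ) :
    IsUnionOfComponents (annulusLevel n) {ζ | ζ ∈ annulus ∧ annulusFun ζ < 0} := by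
  refine isUnionOfComponents_of_isOpen (annulusLevel_subset n) (isOpen_annulusLevel n) ?_
  rintro ζ ⟨⟨hζ, hneg⟩, hcl⟩
  have hg := growth_pos
  rcases lt_or_ge 0 ζ.re with h | h
  · rw [annulusFun, transplant_of_pos _ h] at hneg
    have hlog := (analyticAt_logCoord (mem_slitPlane_of_re_pos h)).continuousAt
    refine mem_annulusLevel.2 ⟨hζ, h, negative_inter_closure_dyadicLevel_wells n
      ⟨⟨logCoord_mem_strip h, hneg⟩, ?_⟩⟩
    have hsub : logCoord '' annulusLevel n ⊆ dyadicLevel wells n := by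
      rintro _ ⟨w, hw, rfl⟩
      exact (mem_annulusLevel.1 hw).2.2
    exact closure_mono hsub
      (hlog.continuousWithinAt.mem_closure_image hcl)
  -- For `Re ζ ≤ 0` the function is at least `5 * growth`, so a negative point cannot lie there.
  · rw [annulusFun, transplant_of_nonpos _ h] at hneg
    nlinarith

theorem disjoint_annulusLevel {m n : ℕ} (hmn : m ≠ n) :
    Disjoint (annulusLevel m) (annulusLevel n) := by
  rw [Set.disjoint_left]
  intro ζ hm hn
  exact Set.disjoint_left.1 (disjoint_dyadicLevel_wells hmn)
    (mem_annulusLevel.1 hm).2.2 (mem_annulusLevel.1 hn).2.2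

/-- The angles at which the circle of radius `r` lies in the set of level `n`. -/
def levelAngles (n : ℕ) (r : ℝ) : Set ℝ :=
  {θ | θ ∈ Ioc (-Real.pi) Real.pi ∧ circleMap 0 r θ ∈ annulusLevel n}

theorem measurableSet_levelAngles (n : ℕ) (r : ℝ) : MeasurableSet (levelAngles n r) :=
  measurableSet_Ioc.inter ((isOpen_annulusLevel n).preimage (continuous_circleMap 0 r)).measurableSet

theorem integrableOn_levelAngles (n : ℕ) (r : ℝ) :
    IntegrableOn (fun θ : ℝ => annulusFun (circleMap 0 r θ)) (levelAngles n r) := by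
  have hmeas := measurableSet_levelAngles n r
  refine IntegrableOn.of_bound (C := 85 * growth) ?_ ?_ ?_
  · exact ((measure_mono fun θ hθ => hθ.1).trans_lt measure_Ioc_lt_top)
  · exact (continuousOn_annulusFun.comp (continuous_circleMap 0 r).continuousOn
      fun θ hθ => hθ.2.1).aestronglyMeasurable hmeas
  · filter_upwards [ae_restrict_mem hmeas] with θ hθ
    exact abs_annulusFun_le hθ.2.1

theorem exists_interval_annulusFun_le (n : ℕ) {r : ℝ} (h1 : 1 < r) (h2 : r < 2) :
    ∃ a : ℝ, ∀ θ ∈ Icc a (a + 3 / 160 / 2 ^ n), θ ∈ levelAngles n r ∧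
      annulusFun (circleMap 0 r θ) ≤ -60 * (growth ^ n)⁻¹ := by
  have hpi := Real.pi_pos
  have hpi3 := Real.pi_gt_three
  have hr : 0 < r := by linarith
  have hn : (0 : ℝ) < 2 ^ n := by positivity
  -- The circle of radius `r` becomes a vertical line in the logarithmic coordinate; multiplication
  -- by `2ⁿ` brings level `n` back to the fundamental wells.
  obtain ⟨s, hs, hv⟩ := exists_sign_selfSimilarFun_le (2 ^ n * (8 / (3 * Real.pi) * Real.log r))
  have hss : s * s = 1 := by rw [← abs_mul_abs_self, hs, one_mul]
  have hinv : 1 / (20 * Real.pi) < 1 / 6 := one_div_lt_one_div_of_lt (by norm_num) (by linarith)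
  have main : ∀ y : ℝ, 1 - 1 / (20 * Real.pi) ≤ y → y ≤ 1 →
      s * (3 * Real.pi / 8 * y / 2 ^ n) ∈ levelAngles n r ∧
      annulusFun (circleMap 0 r (s * (3 * Real.pi / 8 * y / 2 ^ n))) ≤ -60 * (growth ^ n)⁻¹ := by
    intro y hy1 hy2
    set θ := s * (3 * Real.pi / 8 * y / 2 ^ n) with hθ
    have hy0 : 0 < y := by linarith
    have habs : |θ| < Real.pi / 2 := by
      rw [hθ, abs_mul, hs, one_mul, abs_of_pos (by positivity), div_lt_iff₀ hn]
      have : (1 : ℝ) ≤ 2 ^ n := one_le_pow₀ (by norm_num)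
      nlinarith
    have hθ' := abs_lt.1 habs
    have hmem : θ ∈ Ioc (-Real.pi) Real.pi := ⟨by linarith, by linarith⟩
    have hexp : circleMap 0 r θ = r * (Complex.cos θ + Complex.sin θ * Complex.I) := by
      rw [circleMap, zero_add, Complex.exp_mul_I]
    have harg : (circleMap 0 r θ).arg = θ := by
      rw [hexp, Complex.arg_mul_cos_add_sin_mul_I hr hmem]
    have hnorm : ‖circleMap 0 r θ‖ = r := by
      rw [norm_circleMap_zero, abs_of_pos hr]
    have hann : circleMap 0 r θ ∈ annulus := by
      rw [annulus, mem_ofPred_eq, hnorm]; exact ⟨h1, h2⟩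
    have hne : circleMap 0 r θ ≠ 0 := by
      rw [← norm_pos_iff, hnorm]; exact hr
    have hre : 0 < (circleMap 0 r θ).re := by
      have := Complex.abs_arg_lt_pi_div_two_iff.1 (harg.symm ▸ habs)
      exact this.resolve_right hne
    have hlog : 2 ^ n * logCoord (circleMap 0 r θ)
        = ((2 ^ n * (8 / (3 * Real.pi) * Real.log r) : ℝ) : ℂ) + (s * y : ℝ) * Complex.I := by
      have : s * y = 2 ^ n * (8 / (3 * Real.pi) * θ) := by
        rw [hθ]; field_simp
      rw [logCoord, Complex.log, hnorm, harg, this]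
      push_cast; ring
    have hval := hv y hy1 hy2
    rw [← hlog] at hval
    have him : |(2 ^ n * logCoord (circleMap 0 r θ)).im| = y := by
      rw [hlog, Complex.add_im, Complex.ofReal_im, zero_add, Complex.im_ofReal_mul, Complex.I_im,
        mul_one, abs_mul, hs, one_mul, abs_of_pos hy0]
    have hstrip : 2 ^ n * logCoord (circleMap 0 r θ) ∈ strip := by
      change |(2 ^ n * logCoord (circleMap 0 r θ)).im| < 4 / 3
      rw [him]; linarith
    have hdm : dyadicMap n 0 (2 ^ n * logCoord (circleMap 0 r θ)) = logCoord (circleMap 0 r θ) := by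
      rw [dyadicMap, Int.cast_zero, add_zero, mul_div_cancel_left₀ _ (pow_ne_zero n two_ne_zero)]
    refine ⟨⟨hmem, mem_annulusLevel.2 ⟨hann, hre, mem_iUnion.2 ⟨0, _, ⟨⟨hstrip, by linarith⟩, ?_⟩,
      hdm⟩⟩⟩, ?_⟩
    · rw [him]; linarith
    · rw [annulusFun, transplant_of_pos _ hre, ← hdm, selfSimilarFun_dyadicMap n 0 hstrip, mul_comm]
      exact mul_le_mul_of_nonneg_right hval (inv_pos.2 (pow_pos growth_pos n)).le
  -- A well segment of height `1 / (20π)` spans the angle `(3π/8) / (20π) = 3/160`, divided by `2ⁿ`.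
  have hb : 3 * Real.pi / 8 * (1 - 1 / (20 * Real.pi)) / 2 ^ n
      = 3 * Real.pi / 8 / 2 ^ n - 3 / 160 / 2 ^ n := by
    field_simp; ring
  have hs' : s = 1 ∨ s = -1 := mul_self_eq_one_iff.1 hss
  have conv : ∀ t : ℝ, 3 * Real.pi / 8 / 2 ^ n - 3 / 160 / 2 ^ n ≤ t → t ≤ 3 * Real.pi / 8 / 2 ^ n →
      s * t ∈ levelAngles n r ∧ annulusFun (circleMap 0 r (s * t)) ≤ -60 * (growth ^ n)⁻¹ := by
    intro t ht1 ht2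
    have ht : 3 * Real.pi / 8 * (t * 2 ^ n / (3 * Real.pi / 8)) / 2 ^ n = t := by
      field_simp
    have := main (t * 2 ^ n / (3 * Real.pi / 8)) ?_ ?_
    · rwa [ht] at this
    · rw [← hb, div_le_iff₀ hn] at ht1
      rw [le_div_iff₀ (by positivity)]
      linarith
    · rw [le_div_iff₀ hn] at ht2
      rw [div_le_one (by positivity)]
      exact ht2
  rcases hs' with rfl | rfl
  · refine ⟨3 * Real.pi / 8 / 2 ^ n - 3 / 160 / 2 ^ n, fun θ hθ => ?_⟩
    have := conv θ hθ.1 (by linarith [hθ.2])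
    rwa [one_mul] at this
  · refine ⟨-(3 * Real.pi / 8 / 2 ^ n), fun θ hθ => ?_⟩
    have := conv (-θ) (by linarith [hθ.2]) (by linarith [hθ.1])
    rwa [neg_one_mul, neg_neg] at this

theorem integral_levelAngles_le (n : ℕ) {r : ℝ} (h1 : 1 < r) (h2 : r < 2) :
    ∫ θ in levelAngles n r, annulusFun (circleMap 0 r θ) ≤ -((2 * growth) ^ n)⁻¹ := by
  obtain ⟨a, ha⟩ := exists_interval_annulusFun_le n h1 h2
  have hg : 0 < (growth ^ n)⁻¹ := inv_pos.2 (pow_pos growth_pos n)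
  have h2n : (0 : ℝ) < (2 ^ n)⁻¹ := by positivity
  set J := Icc a (a + 3 / 160 / 2 ^ n) with hJ
  have hsub : J ⊆ levelAngles n r := fun θ hθ => (ha θ hθ).1
  have hint := integrableOn_levelAngles n r
  have hvol : volume.real J = 3 / 160 / 2 ^ n := by
    rw [hJ, Real.volume_real_Icc_of_le (by linarith [show (0 : ℝ) ≤ 3 / 160 / 2 ^ n by positivity])]
    ring
  -- The function is negative on all of `levelAngles`, so discarding angles outside `J` only loses
  -- mass of the right sign.
  have hmono : ∫ θ in J, -annulusFun (circleMap 0 r θ)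
      ≤ ∫ θ in levelAngles n r, -annulusFun (circleMap 0 r θ) := by
    refine setIntegral_mono_set hint.neg ?_ (Eventually.of_forall hsub)
    filter_upwards [ae_restrict_mem (measurableSet_levelAngles n r)] with θ hθ
    simpa using (annulusLevel_subset n hθ.2).2.le
  have hconst : 60 * (growth ^ n)⁻¹ * volume.real J
      ≤ ∫ θ in J, -annulusFun (circleMap 0 r θ) := by
    have h := setIntegral_mono_on (μ := volume) (s := J) (f := fun _ => 60 * (growth ^ n)⁻¹)
      (g := fun θ => -annulusFun (circleMap 0 r θ))
      (integrableOn_const (by rw [hJ]; exact measure_Icc_lt_top.ne))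
      (hint.mono_set hsub).neg measurableSet_Icc fun θ hθ => by linarith [(ha θ hθ).2]
    rwa [setIntegral_const, smul_eq_mul, mul_comm] at h
  rw [integral_neg, integral_neg] at hmono
  rw [hvol, integral_neg] at hconst
  rw [mul_pow, mul_inv]
  have hprod := mul_pos h2n hg
  -- Depth times width is `60 · 3/160 = 9/8`, more than the required `1`.
  have : 60 * (growth ^ n)⁻¹ * (3 / 160 / 2 ^ n) = 9 / 8 * ((2 ^ n)⁻¹ * (growth ^ n)⁻¹) := by
    field_simp; norm_num
  linarith

theorem mainTheorem2 :
    ∃ (u : ℂ → ℝ) (E : ℕ → Set ℂ) (c : ℝ),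
      1 < c ∧
      IsSubharmonicOn u annulus ∧
      (∃ B : ℝ, ∀ ζ ∈ annulus, |u ζ| ≤ B) ∧
      (∀ m n : ℕ, m ≠ n → Disjoint (E m) (E n)) ∧
      (∀ n : ℕ, IsOpen (E n) ∧ IsUnionOfComponents (E n) {ζ | ζ ∈ annulus ∧ u ζ < 0}) ∧
      (∀ n : ℕ, ∀ r : ℝ, 1 < r → r < 2 →
        IntegrableOn (fun θ : ℝ => u (circleMap 0 r θ))
          {θ | θ ∈ Ioc (-Real.pi) Real.pi ∧ circleMap 0 r θ ∈ E n} ∧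
        ∫ θ in {θ : ℝ | θ ∈ Ioc (-Real.pi) Real.pi ∧ circleMap 0 r θ ∈ E n},
          u (circleMap 0 r θ) ≤ -(c ^ n)⁻¹) ∧
      -- in a sector of the annulus, `u` and the sets `E n` are self-similar in a logarithmic variable
      (∃ (ε M : ℝ) (v : ℂ → ℝ) (W : Set ℂ),
        0 < ε ∧ ε < Real.pi ∧ 1 < M ∧
        IsSubharmonicOn v strip ∧
        IsSelfSimilar v W M ∧
        (∀ z ∈ strip, Complex.exp ((3 * ε / 4 : ℝ) * z) ∈ annulus →
          u (Complex.exp ((3 * ε / 4 : ℝ) * z)) = v z) ∧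
        (∀ n : ℕ, E n =
          annulus ∩ (fun z : ℂ => Complex.exp ((3 * ε / 4 : ℝ) * z)) '' dyadicLevel W n)) := by
  have hpi := Real.pi_pos
  have hg := growth_gt
  refine ⟨annulusFun, annulusLevel, 2 * growth, by linarith, isSubharmonicOn_annulusFun,
    ⟨_, fun ζ hζ => abs_annulusFun_le hζ⟩, fun m n hmn => disjoint_annulusLevel hmn,
    fun n => ⟨isOpen_annulusLevel n, isUnionOfComponents_annulusLevel n⟩,
    fun n r h1 h2 => ⟨integrableOn_levelAngles n r, integral_levelAngles_le n h1 h2⟩,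
    Real.pi / 2, growth, selfSimilarFun, wells, by linarith, by linarith, by linarith,
    isSubharmonicOn_selfSimilarFun, isSelfSimilar_selfSimilarFun, fun z hz _ => ?_, fun n => rfl⟩
  change annulusFun (sectorMap z) = selfSimilarFun z
  rw [annulusFun, transplant_of_pos _ (sectorMap_re_pos hz), logCoord_sectorMap hz]
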